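/- **Theorem A''.** Let $d\ge 1$ be an integer and let $a,\gamma\in\mathbb R$ satisfy $a<(d-2)/2$, $\gamma\ge d/4$, and moreover $\gamma>1/2$ if $d=2$. Let $\mathcal C=\mathbb R\times\mathbb S^{d-1}$ be the cylinder with its product metric and its Riemannian measure $dy=ds\,d\omega$ (for $d=1$, $\mathbb S^0=\{-1,1\}$ carries the counting measure). Then there is a constant $\mathsf C_{\rm GLH}>0$, depending only on $d$, $a$ and $\gamma$, such that for every real-valued $w\in H^1(\mathcal C)$ with $\int_{\mathcal C}w^2\,dy=1$, $$\int_{\mathcal C}w^2\log w^2\,dy\;\le\;2\gamma\,\log\left(\mathsf C_{\rm GLH}\left[\int_{\mathcal C}|\nabla w|^2\,dy+\frac{(d-2-2a)^2}{4}\right]\right),$$ where the positive part of $w^2\log w^2$ is integrable, so that the left-hand side is well defined in $[-\infty,\infty)$. The smallest such constant $\mathsf C_{\rm GLH}$ exists and is also the smallest positive constant for which $$\int_{\mathbb R^d}\frac{u^2}{|x|^{2(a+1)}}\log\left(|x|^{d-2-2a}u^2\right)dx\;\le\;2\gamma\,\log\left[\mathsf C_{\rm GLH}\int_{\mathbb R^d}\frac{|\nabla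 u|^2}{|x|^{2a}}\,dx\right]$$ holds (in the same sense) for every real-valued $u\in\mathcal D^{1,2}_a(\mathbb R^d)$ with $\int_{\mathbb R^d}|x|^{-2(a+1)}u^2\,dx=1$. Here $\mathcal D^{1,2}_a(\mathbb R^d)$ is the completion, with respect to the norm $\varphi\mapsto\big(\int_{\mathbb R^d}|x|^{-2a}|\nabla \varphi|^2\,dx\big)^{1/2}$, of $C_c^\infty(\mathbb R^d\setminus\{0\})$ if $d\ge2$ and of $\{\varphi\in C^\infty_c(\mathbb R):\varphi'(0)=0\}$ if $d=1$. If $d=1$, the first inequality may equivalently be stated with $\mathcal C$ replaced by the line $\mathbb R$: the smallest constant is the same. -/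

import Mathlib

open MeasureTheory Filter Topology
open scoped ContDiff ENNReal

noncomputable section

/-- The Euclidean space `ℝ^d`. -/
abbrev RSpace (d : ℕ) : Type := EuclideanSpace ℝ (Fin d)

/-- The cylinder `𝒞 = ℝ × S^{d-1}`, with points `y = (s, θ)`. -/
abbrev Cylinder (d : ℕ) : Type := ℝ × Metric.sphere (0 : RSpace d) 1

/-- The Riemannian measure `ds dθ` of the cylinder: Lebesgue measure times the (unnormalized) surface
measure of the unit sphere (counting measure on `S^0 = {-1, 1}` if `d = 1`). -/
def cylinderMeasure (d : ℕ) : Measure (Cylinder d) :=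
  (volume : Measure ℝ).prod (volume : Measure (RSpace d)).toSphere

/-- `∫ f dμ ≤ B`, the integral being taken in `[-∞, ∞)`: the positive part of `f` is integrable, so
that `∫ f dμ` is either finite and at most `B`, or equal to `-∞`. -/
def IntegralLE {X : Type*} [MeasurableSpace X] (μ : Measure X) (f : X → ℝ) (B : ℝ) : Prop :=
  Integrable (fun x => max (f x) 0) μ ∧ (Integrable f μ → ∫ x, f x ∂μ ≤ B)

/-! ### The Sobolev space `H¹(ℝ × S^{d-1})` -/

/-- The restriction to the cylinder of a function on `ℝ × ℝ^d`. Smooth functions on the cylinder,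
which is a closed submanifold of `ℝ × ℝ^d`, are exactly the restrictions of smooth functions. -/
def cylinderRestrict {d : ℕ} (φ : ℝ × RSpace d → ℝ) (y : Cylinder d) : ℝ :=
  φ (y.1, (y.2 : RSpace d))

/-- The Riemannian gradient on the cylinder of the restriction of `φ`: its components are the
derivative in `s` and the tangential part `g - ⟨g, θ⟩ θ` of the gradient `g` in `θ ∈ S^{d-1}`. The norm on
`WithLp 2 (ℝ × ℝ^d)` is the Euclidean one. -/
def cylinderGrad {d : ℕ} (φ : ℝ × RSpace d → ℝ) (y : Cylinder d) : WithLp 2 (ℝ × RSpace d) :=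
  let θ : RSpace d := y.2
  let g : RSpace d := gradient (fun x : RSpace d => φ (y.1, x)) θ
  WithLp.toLp 2 (deriv (fun s : ℝ => φ (s, θ)) y.1, g - (inner ℝ g θ) • θ)

/-- `w ∈ H¹(𝒞)` with gradient `∇w = G`. Here `H¹(𝒞)` is the completion of the space of smooth
functions `φ` on `𝒞` with `∫ |φ|² + ∫ |∇φ|² < ∞` for the norm `(∫ |φ|² + ∫ |∇φ|²)^{1/2}`, realized
as a space of functions: `φₙ → w` and `∇φₙ → G` in `L²(𝒞)`. -/
def IsH1Cylinder (d : ℕ) (w : Cylinder d → ℝ) (G : Cylinder d → WithLp 2 (ℝ × RSpace d)) : Prop :=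
  MemLp w 2 (cylinderMeasure d) ∧ MemLp G 2 (cylinderMeasure d) ∧
  ∃ φ : ℕ → ℝ × RSpace d → ℝ,
    (∀ n, ContDiff ℝ ∞ (φ n) ∧ MemLp (cylinderRestrict (φ n)) 2 (cylinderMeasure d) ∧
      MemLp (cylinderGrad (φ n)) 2 (cylinderMeasure d)) ∧
    Tendsto (fun n => eLpNorm (fun y => cylinderRestrict (φ n) y - w y) 2 (cylinderMeasure d))
      atTop (𝓝 0) ∧
    Tendsto (fun n => eLpNorm (fun y => cylinderGrad (φ n) y - G y) 2 (cylinderMeasure d))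
      atTop (𝓝 0)

/-- The logarithmic Hardy inequality on the cylinder `ℝ × S^{d-1}`, with constant `C`. -/
def CylinderLogHardy (d : ℕ) (a γ C : ℝ) : Prop :=
  ∀ (w : Cylinder d → ℝ) (G : Cylinder d → WithLp 2 (ℝ × RSpace d)), IsH1Cylinder d w G →
    (∫ y, w y ^ 2 ∂(cylinderMeasure d)) = 1 →
    IntegralLE (cylinderMeasure d) (fun y => w y ^ 2 * Real.log (w y ^ 2))
      (2 * γ * Real.log (C * ((∫ y, ‖G y‖ ^ 2 ∂(cylinderMeasure d)) + ((d : ℝ) - 2 - 2 * a) ^ 2 / 4)))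

/-! ### The line, as the cylinder in dimension `d = 1` -/

/-- `w ∈ H¹(ℝ)` with derivative `w' = g`, as the completion of the smooth functions of finite norm. -/
def IsH1Line (w g : ℝ → ℝ) : Prop :=
  MemLp w 2 volume ∧ MemLp g 2 volume ∧
  ∃ φ : ℕ → ℝ → ℝ,
    (∀ n, ContDiff ℝ ∞ (φ n) ∧ MemLp (φ n) 2 volume ∧ MemLp (deriv (φ n)) 2 volume) ∧
    Tendsto (fun n => eLpNorm (fun s => φ n s - w s) 2 volume) atTop (𝓝 0) ∧
    Tendsto (fun n => eLpNorm (fun s => deriv (φ n) s - g s) 2 volume) atTop (𝓝 0)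

/-- The logarithmic Hardy inequality on `ℝ`, with constant `C`; here
`(d - 2 - 2a)² / 4 = (1 + 2a)² / 4` for `d = 1`. -/
def LineLogHardy (a γ C : ℝ) : Prop :=
  ∀ w g : ℝ → ℝ, IsH1Line w g → (∫ s, w s ^ 2) = 1 →
    IntegralLE volume (fun s => w s ^ 2 * Real.log (w s ^ 2))
      (2 * γ * Real.log (C * ((∫ s, g s ^ 2) + ((1 : ℝ) - 2 - 2 * a) ^ 2 / 4)))

/-! ### The weighted inequality on `ℝ^d` -/

/-- The weighted measure `|x|^{-2b} dx` on `ℝ^d`. -/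
def hardyMeasure (d : ℕ) (b : ℝ) : Measure (RSpace d) :=
  (volume : Measure (RSpace d)).withDensity (fun x => ENNReal.ofReal (‖x‖ ^ (-(2 * b))))

/-- The test functions: `𝒟(ℝ^d ∖ {0})` if `d ≥ 2`, and `{φ ∈ 𝒟(ℝ) : φ'(0) = 0}` if `d = 1`. -/
def IsHardyTest (d : ℕ) (φ : RSpace d → ℝ) : Prop :=
  ContDiff ℝ ∞ φ ∧ HasCompactSupport φ ∧
    (d = 1 → fderiv ℝ φ 0 = 0) ∧ (d ≠ 1 → (0 : RSpace d) ∉ tsupport φ)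

/-- `u ∈ 𝒟^{1,2}_a(ℝ^d)` with gradient `∇u = G`. This space is the completion of the test functions
for the norm `(∫ |x|^{-2a} |∇φ|² dx)^{1/2}`, which controls the norm of `L²(|x|^{-2(a+1)} dx)` by
Hardy's inequality, and is thereby realized as a space of functions. -/
def IsD12 (d : ℕ) (a : ℝ) (u : RSpace d → ℝ) (G : RSpace d → RSpace d) : Prop :=
  MemLp u 2 (hardyMeasure d (a + 1)) ∧ MemLp G 2 (hardyMeasure d a) ∧
  ∃ φ : ℕ → RSpace d → ℝ,
    (∀ n, IsHardyTest d (φ n)) ∧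
    Tendsto (fun n => eLpNorm (fun x => φ n x - u x) 2 (hardyMeasure d (a + 1))) atTop (𝓝 0) ∧
    Tendsto (fun n => eLpNorm (fun x => gradient (φ n) x - G x) 2 (hardyMeasure d a)) atTop (𝓝 0)

/-- The weighted logarithmic Hardy inequality on `ℝ^d`, with constant `C`. -/
def WeightedLogHardy (d : ℕ) (a γ C : ℝ) : Prop :=
  ∀ (u : RSpace d → ℝ) (G : RSpace d → RSpace d), IsD12 d a u G →
    (∫ x, u x ^ 2 ∂(hardyMeasure d (a + 1))) = 1 →
    IntegralLE (hardyMeasure d (a + 1))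
      (fun x => u x ^ 2 * Real.log (‖x‖ ^ ((d : ℝ) - 2 - 2 * a) * u x ^ 2))
      (2 * γ * Real.log (C * (∫ x, ‖G x‖ ^ 2 ∂(hardyMeasure d a))))

end

/-! Put α = (d-2-2a)/2 > 0. The Emden–Fowler substitution w(s,θ) = e^{αs} u(e^s θ) carries
L²(|x|^{-2(a+1)} dx) isometrically onto L²(𝒞), and the weight inside the logarithm is exactly what
turns u² into w². Up to a power of e^s, the gradient of u has radial part ∂_s w - αw and tangential
part ∇_θ w. Hence its weighted energy is ∫|∇w|² + α²∫w² - 2α∫w ∂_s w, and the last integral vanishes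
because w ∂_s w is an s-derivative. The two spaces correspond as well, since functions on 𝒞
truncated in s become test functions on ℝ^d. So the weighted inequality and the cylinder inequality
hold for the same constants (`weightedLogHardy_iff`).

A constant exists because a higher norm controls the entropy by Jensen (`integralLE_sq_mul_log_sq`).
Let E be the bracket in the inequality. For d ≥ 2 the embedding of W^{1,1} in L^{d/(d-1)}, applied
to |x|^{-(d-1)} w², bounds the L^{d/(d-1)} norm of w² by a multiple of √E. For d = 1 the fundamental
theorem of calculus gives w² ≤ 2√E on the line. In both cases the entropy is at most L + (d/2) log
E. As d/2 ≤ 2γ and E is bounded below by α² > 0, this is at most 2γ log(K E) for a suitable K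
(`exists_constant_of_log_bound`).

For d = 1 the cylinder is two copies of ℝ. A function on ℝ extends by zero to the second copy;
conversely, concavity of log shows that sharing the mass between the copies needs no larger
constant.

Finally, the admissible constants are bounded away from 0 by one function of finite entropy, and the
inequality passes to the limit in the constant, so the infimum is attained. -/

noncomputable section

/-! ### Polar coordinates and the weighted measures. -/

/-- Logarithmic polar coordinates `(s, θ) ↦ e^s θ`. -/
def logPolar (d : ℕ) (y : Cylinder d) : RSpace d := Real.exp y.1 • (y.2 : RSpace d)

theorem continuous_logPolar (d : ℕ) : Continuous (logPolar d) := by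
  unfold logPolar; fun_prop

theorem norm_sphere {d : ℕ} (θ : Metric.sphere (0 : RSpace d) 1) : ‖(θ : RSpace d)‖ = 1 := by
  simp

theorem norm_logPolar {d : ℕ} (y : Cylinder d) : ‖logPolar d y‖ = Real.exp y.1 := by
  simp [logPolar, norm_smul]

theorem logPolar_ne_zero {d : ℕ} (y : Cylinder d) : logPolar d y ≠ 0 := by
  rw [← norm_pos_iff, norm_logPolar]; positivity

theorem log_norm_logPolar {d : ℕ} (y : Cylinder d) : Real.log ‖logPolar d y‖ = y.1 := by
  rw [norm_logPolar, Real.log_exp]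

theorem normalize_logPolar {d : ℕ} (y : Cylinder d) :
    ‖logPolar d y‖⁻¹ • logPolar d y = (y.2 : RSpace d) := by
  rw [norm_logPolar, logPolar, smul_smul, inv_mul_cancel₀ (Real.exp_pos _).ne', one_smul]

theorem logPolar_injective (d : ℕ) : Function.Injective (logPolar d) := by
  intro y z h
  refine Prod.ext ?_ (Subtype.ext ?_)
  · rw [← log_norm_logPolar, h, log_norm_logPolar]
  · rw [← normalize_logPolar, h, normalize_logPolar]

theorem measurableEmbedding_logPolar (d : ℕ) : MeasurableEmbedding (logPolar d) :=
  (continuous_logPolar d).measurableEmbedding (logPolar_injective d)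

instance (d : ℕ) : SFinite (cylinderMeasure d) := by
  unfold cylinderMeasure; infer_instance

instance (d : ℕ) : SigmaFinite (cylinderMeasure d) := by
  unfold cylinderMeasure; infer_instance

/-- Substitution r = e^s; the Jacobian e^s accounts for the 1 added to n. -/
theorem lintegral_volumeIoiPow (n : ℕ) (f : ℝ → ℝ≥0∞) (hf : Measurable f) :
    ∫⁻ r : Set.Ioi (0 : ℝ), f r ∂(Measure.volumeIoiPow n) =
      ∫⁻ s : ℝ, ENNReal.ofReal (Real.exp ((n + 1) * s)) * f (Real.exp s) := by
  rw [Measure.volumeIoiPow, lintegral_withDensity_eq_lintegral_mul _ (by fun_prop) (by fun_prop)]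
  have h1 := lintegral_subtype_comap (μ := (volume : Measure ℝ)) (measurableSet_Ioi (a := (0 : ℝ)))
    (fun r => ENNReal.ofReal (r ^ n) * f r)
  simp only [Pi.mul_apply]
  rw [h1, ← Real.range_exp, ← Set.image_univ,
    lintegral_image_eq_lintegral_abs_deriv_mul MeasurableSet.univ
      (fun x _ => (Real.hasDerivAt_exp x).hasDerivWithinAt) Real.exp_injective.injOn,
    Measure.restrict_univ]
  refine lintegral_congr fun s => ?_
  rw [← mul_assoc, ← ENNReal.ofReal_mul (abs_nonneg _), abs_of_pos (Real.exp_pos _),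
    ← Real.exp_nat_mul, ← Real.exp_add]
  ring_nf

theorem lintegral_logPolar {d : ℕ} (hd : 1 ≤ d) (f : RSpace d → ℝ≥0∞) (hf : Measurable f) :
    ∫⁻ x, f x = ∫⁻ y, ENNReal.ofReal (Real.exp (d * y.1)) * f (logPolar d y)
      ∂(cylinderMeasure d) := by
  have : Nontrivial (RSpace d) := by
    have : Nonempty (Fin d) := ⟨⟨0, hd⟩⟩
    infer_instance
  have h0 : ∫⁻ x, f x = ∫⁻ x : ({0}ᶜ : Set (RSpace d)), f x
      ∂(Measure.comap (↑) (volume : Measure (RSpace d))) := by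
    rw [lintegral_subtype_comap (measurableSet_singleton _).compl, restrict_compl_singleton]
  have hmp := (volume : Measure (RSpace d)).measurePreserving_homeomorphUnitSphereProd
  have h1 := hmp.lintegral_comp_emb (Homeomorph.measurableEmbedding _)
    (fun p => f (p.2.1 • (p.1 : RSpace d)))
  have h2 : ∀ x : ({0}ᶜ : Set (RSpace d)),
      f ((homeomorphUnitSphereProd (RSpace d) x).2.1 •
        ((homeomorphUnitSphereProd (RSpace d) x).1 : RSpace d)) = f x := by
    intro x
    have : ‖(x : RSpace d)‖ ≠ 0 := norm_ne_zero_iff.2 x.2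
    simp [smul_smul, this]
  simp only [h2] at h1
  rw [h0, h1, lintegral_prod _ (by fun_prop), cylinderMeasure, lintegral_prod_symm _ (by
    unfold logPolar; fun_prop)]
  refine lintegral_congr fun θ => ?_
  rw [lintegral_volumeIoiPow _ (fun r => f (r • (θ : RSpace d))) (by fun_prop)]
  have : ((Module.finrank ℝ (RSpace d) - 1 : ℕ) : ℝ) + 1 = d := by
    rw [finrank_euclideanSpace_fin, Nat.cast_sub hd]; simp
  simp only [this, logPolar]

theorem measurePreserving_logPolar {d : ℕ} (hd : 1 ≤ d) (b : ℝ) :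
    MeasurePreserving (logPolar d)
      ((cylinderMeasure d).withDensity fun y => ENNReal.ofReal (Real.exp ((d - 2 * b) * y.1)))
      (hardyMeasure d b) := by
  refine ⟨(continuous_logPolar d).measurable, Measure.ext_of_lintegral _ fun f hf => ?_⟩
  have hg : Measurable fun y => f (logPolar d y) := hf.comp (continuous_logPolar d).measurable
  rw [lintegral_map hf (continuous_logPolar d).measurable,
    lintegral_withDensity_eq_lintegral_mul _ (by fun_prop) hg, hardyMeasure,
    lintegral_withDensity_eq_lintegral_mul _ (by fun_prop) hf, lintegral_logPolar hd _ (by fun_prop)]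
  refine lintegral_congr fun y => ?_
  simp only [Pi.mul_apply, ← mul_assoc, norm_logPolar]
  rw [← ENNReal.ofReal_mul (Real.exp_pos _).le, ← Real.exp_mul, ← Real.exp_add]
  ring_nf

/-! ### Transport of L² norms and integrals to the cylinder. -/

/-- The weight by which a function on `ℝ^d` is to be multiplied to turn `L²(|x|^{-2b} dx)` into
`L²(𝒞)`. -/
def polarWeight (d : ℕ) (b : ℝ) (y : Cylinder d) : ℝ := Real.exp ((d - 2 * b) / 2 * y.1)

theorem polarWeight_pos {d : ℕ} (b : ℝ) (y : Cylinder d) : 0 < polarWeight d b y := Real.exp_pos _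

theorem continuous_polarWeight (d : ℕ) (b : ℝ) : Continuous (polarWeight d b) := by
  unfold polarWeight; fun_prop

theorem polarWeight_sq {d : ℕ} (b : ℝ) (y : Cylinder d) :
    polarWeight d b y ^ 2 = Real.exp ((d - 2 * b) * y.1) := by
  rw [polarWeight, ← Real.exp_nat_mul]; ring_nf

section transport
variable {d : ℕ} {E : Type*} [NormedAddCommGroup E] [NormedSpace ℝ E]

theorem measurePreserving_logPolar' (hd : 1 ≤ d) (b : ℝ) :
    MeasurePreserving (logPolar d)
      ((cylinderMeasure d).withDensity fun y => ((polarWeight d b y ^ 2).toNNReal : ℝ≥0∞))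
      (hardyMeasure d b) := by
  simp only [polarWeight_sq]
  exact measurePreserving_logPolar hd b

theorem aestronglyMeasurable_logPolar (hd : 1 ≤ d) (b : ℝ) (f : RSpace d → E) :
    AEStronglyMeasurable f (hardyMeasure d b) ↔
      AEStronglyMeasurable (fun y => polarWeight d b y • f (logPolar d y)) (cylinderMeasure d) := by
  rw [← (measurePreserving_logPolar' hd b).aestronglyMeasurable_comp_iff
    (measurableEmbedding_logPolar d)]
  have hm : Measurable fun y : Cylinder d => (polarWeight d b y ^ 2).toNNReal := by
    have := (continuous_polarWeight d b).measurable
    fun_prop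
  rw [aestronglyMeasurable_withDensity_iff hm]
  have h : ∀ y : Cylinder d, ((polarWeight d b y ^ 2).toNNReal : ℝ) = polarWeight d b y ^ 2 :=
    fun y => Real.coe_toNNReal _ (by positivity)
  simp only [Function.comp_apply, h]
  constructor <;> intro H
  · have := ((continuous_polarWeight d b).inv₀
      fun y => (polarWeight_pos b y).ne').aestronglyMeasurable (μ := cylinderMeasure d) |>.smul H
    refine this.congr (ae_of_all _ fun y => ?_)
    have := (polarWeight_pos b y).ne'
    simp only [Pi.smul_apply', Pi.inv_apply, smul_smul]
    congr 1; field_simp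
  · have := (continuous_polarWeight d b).aestronglyMeasurable (μ := cylinderMeasure d) |>.smul H
    refine this.congr (ae_of_all _ fun y => ?_)
    simp only [Pi.smul_apply', smul_smul, sq]

/-- Since `logPolar` is a measurable embedding and the density is finite, f need not be measurable.
-/
theorem eLpNorm_logPolar (hd : 1 ≤ d) (b : ℝ) (f : RSpace d → E) :
    eLpNorm f 2 (hardyMeasure d b) =
      eLpNorm (fun y => polarWeight d b y • f (logPolar d y)) 2 (cylinderMeasure d) := by
  rw [eLpNorm_eq_lintegral_rpow_enorm_toReal (by simp) (by simp),
    eLpNorm_eq_lintegral_rpow_enorm_toReal (by simp) (by simp),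
    ← (measurePreserving_logPolar' hd b).lintegral_comp_emb (measurableEmbedding_logPolar d),
    lintegral_withDensity_eq_lintegral_mul_non_measurable]
  · congr 1
    refine lintegral_congr fun y => ?_
    simp only [Pi.mul_apply, enorm_smul, ENNReal.toReal_ofNat, ENNReal.rpow_ofNat, mul_pow]
    congr 1
    rw [Real.enorm_eq_ofReal (polarWeight_pos b y).le,
      ← ENNReal.ofReal_pow (polarWeight_pos b y).le, ENNReal.ofReal]
  · have := (continuous_polarWeight d b).measurable
    fun_prop
  · exact ae_of_all _ fun y => by simp

theorem memLp_logPolar (hd : 1 ≤ d) (b : ℝ) (f : RSpace d → E) :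
    MemLp f 2 (hardyMeasure d b) ↔
      MemLp (fun y => polarWeight d b y • f (logPolar d y)) 2 (cylinderMeasure d) := by
  unfold MemLp
  rw [eLpNorm_logPolar hd, aestronglyMeasurable_logPolar hd]

theorem integrable_logPolar (hd : 1 ≤ d) (b : ℝ) (f : RSpace d → ℝ) :
    Integrable f (hardyMeasure d b) ↔
      Integrable (fun y => polarWeight d b y ^ 2 * f (logPolar d y)) (cylinderMeasure d) := by
  rw [← (measurePreserving_logPolar' hd b).integrable_comp_emb (measurableEmbedding_logPolar d),
    integrable_withDensity_iff_integrable_smul]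
  · refine iff_of_eq (congrArg (Integrable · _) (funext fun y => ?_))
    rw [NNReal.smul_def, Real.coe_toNNReal _ (by positivity)]
    rfl
  · have := (continuous_polarWeight d b).measurable
    fun_prop

theorem integral_logPolar (hd : 1 ≤ d) (b : ℝ) (f : RSpace d → ℝ) :
    ∫ x, f x ∂(hardyMeasure d b) =
      ∫ y, polarWeight d b y ^ 2 * f (logPolar d y) ∂(cylinderMeasure d) := by
  rw [← (measurePreserving_logPolar' hd b).integral_comp (measurableEmbedding_logPolar d),
    integral_withDensity_eq_integral_smul]
  · refine integral_congr_ae (ae_of_all _ fun y => ?_)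
    simp only [NNReal.smul_def, Real.coe_toNNReal _ (sq_nonneg _), smul_eq_mul]
  · have := (continuous_polarWeight d b).measurable
    fun_prop

end transport

/-! ### Pointwise algebra of the Emden–Fowler gradient. -/

section algebra
variable {d : ℕ}

/-- The gradient of `u` at `e^s θ`, up to the factor `e^{-(α+1)s}`, in terms of the value and the gradient
at `(s, θ)` of `w = e^{αs} u(e^s θ)`. -/
def cylToSpace (α : ℝ) (θ : RSpace d) (w : ℝ) (G : WithLp 2 (ℝ × RSpace d)) : RSpace d :=
  (G.fst - α * w) • θ + (G.snd - (inner ℝ G.snd θ) • θ)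

/-- The inverse operation to `cylToSpace`. -/
def spaceToCyl (α : ℝ) (θ : RSpace d) (w : ℝ) (h : RSpace d) : WithLp 2 (ℝ × RSpace d) :=
  WithLp.toLp 2 (α * w + inner ℝ h θ, h - (inner ℝ h θ) • θ)

theorem cylToSpace_sub (α : ℝ) (θ : RSpace d) (w w' : ℝ) (G G' : WithLp 2 (ℝ × RSpace d)) :
    cylToSpace α θ (w - w') (G - G') = cylToSpace α θ w G - cylToSpace α θ w' G' := by
  simp only [cylToSpace, WithLp.sub_fst, WithLp.sub_snd, inner_sub_left]
  module

theorem spaceToCyl_sub (α : ℝ) (θ : RSpace d) (w w' : ℝ) (h h' : RSpace d) :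
    spaceToCyl α θ (w - w') (h - h') = spaceToCyl α θ w h - spaceToCyl α θ w' h' := by
  simp only [spaceToCyl, ← WithLp.toLp_sub, Prod.mk_sub_mk, inner_sub_left]
  congr 2
  · ring
  · module

theorem inner_proj {θ : RSpace d} (hθ : ‖θ‖ = 1) (g : RSpace d) :
    inner ℝ (g - (inner ℝ g θ) • θ) θ = 0 := by
  rw [inner_sub_left, inner_smul_left, real_inner_self_eq_norm_sq, hθ]
  simp

theorem norm_proj_le {θ : RSpace d} (hθ : ‖θ‖ = 1) (g : RSpace d) :
    ‖g - (inner ℝ g θ) • θ‖ ≤ ‖g‖ := by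
  have h := norm_add_sq_real (g - (inner ℝ g θ) • θ) ((inner ℝ g θ) • θ)
  rw [inner_smul_right, inner_proj hθ, sub_add_cancel] at h
  refine le_of_sq_le_sq ?_ (norm_nonneg _)
  nlinarith [sq_nonneg ‖(inner ℝ g θ) • θ‖]

/-- Only this composition is the identity on all vectors; the opposite one replaces `G.snd` by its
tangential part. -/
theorem cylToSpace_spaceToCyl (α : ℝ) {θ : RSpace d} (hθ : ‖θ‖ = 1) (w : ℝ) (h : RSpace d) :
    cylToSpace α θ w (spaceToCyl α θ w h) = h := by
  simp only [cylToSpace, spaceToCyl, WithLp.toLp_fst, WithLp.toLp_snd, inner_proj hθ]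
  module

theorem norm_cylToSpace_le (α : ℝ) {θ : RSpace d} (hθ : ‖θ‖ = 1) (w : ℝ)
    (G : WithLp 2 (ℝ × RSpace d)) : ‖cylToSpace α θ w G‖ ≤ |α| * ‖w‖ + 2 * ‖G‖ := by
  have h1 := WithLp.norm_fst_le (p := 2) (x := G)
  have h2 := WithLp.norm_snd_le (p := 2) (x := G)
  calc ‖cylToSpace α θ w G‖ ≤ ‖(G.fst - α * w) • θ‖ + ‖G.snd - (inner ℝ G.snd θ) • θ‖ :=
        norm_add_le _ _
    _ ≤ (‖G‖ + |α| * ‖w‖) + ‖G‖ := by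
        refine add_le_add ?_ ((norm_proj_le hθ _).trans h2)
        rw [norm_smul, hθ, mul_one]
        refine (norm_sub_le _ _).trans (add_le_add h1 ?_)
        rw [norm_mul, Real.norm_eq_abs α]
    _ = _ := by ring

theorem norm_spaceToCyl_le (α : ℝ) {θ : RSpace d} (hθ : ‖θ‖ = 1) (w : ℝ) (h : RSpace d) :
    ‖spaceToCyl α θ w h‖ ≤ |α| * ‖w‖ + 2 * ‖h‖ := by
  have e : spaceToCyl α θ w h = WithLp.toLp 2 (α * w + inner ℝ h θ, (0 : RSpace d)) +
      WithLp.toLp 2 ((0 : ℝ), h - (inner ℝ h θ) • θ) := by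
    simp [spaceToCyl, ← WithLp.toLp_add]
  rw [e]
  refine (norm_add_le _ _).trans ?_
  rw [WithLp.norm_toLp_fst, WithLp.norm_toLp_snd]
  have h1 : ‖(inner ℝ h θ : ℝ)‖ ≤ ‖h‖ := by
    simpa [hθ] using norm_inner_le_norm (𝕜 := ℝ) h θ
  have h2 := norm_add_le (α * w) (inner ℝ h θ)
  rw [norm_mul, Real.norm_eq_abs α] at h2
  linarith [norm_proj_le hθ h]

/-- Radial and tangential parts are orthogonal. When G is the gradient of w, the cross term is the
s-derivative of -αw², which is why it disappears after integration. -/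
theorem norm_sq_cylToSpace (α : ℝ) {θ : RSpace d} (hθ : ‖θ‖ = 1) (w : ℝ)
    {G : WithLp 2 (ℝ × RSpace d)} (hG : inner ℝ G.snd θ = 0) :
    ‖cylToSpace α θ w G‖ ^ 2 = ‖G‖ ^ 2 + α ^ 2 * w ^ 2 - 2 * α * (w * G.fst) := by
  rw [cylToSpace, hG, zero_smul, sub_zero, norm_add_sq_real, inner_smul_left, real_inner_comm, hG,
    norm_smul, hθ, mul_one, WithLp.prod_norm_sq_eq_of_L2, Real.norm_eq_abs, sq_abs,
    Real.norm_eq_abs, sq_abs]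
  simp
  ring

end algebra

/-! ### Gradients under the change of variables. -/

section gradient
variable {d : ℕ}

theorem inner_gradient {f : RSpace d → ℝ} {x v : RSpace d} :
    inner ℝ (gradient f x) v = fderiv ℝ f x v := by
  rw [← toDual_gradient, InnerProductSpace.toDual_apply_apply]

theorem norm_gradient {f : RSpace d → ℝ} {x : RSpace d} : ‖gradient f x‖ = ‖fderiv ℝ f x‖ := by
  rw [← toDual_gradient, LinearIsometryEquiv.norm_map]

theorem cylinderGrad_fst {φ : ℝ × RSpace d → ℝ} {φ' : ℝ × RSpace d →L[ℝ] ℝ} {y : Cylinder d}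
    (h : HasFDerivAt φ φ' (y.1, (y.2 : RSpace d))) : (cylinderGrad φ y).fst = φ' (1, 0) := by
  have h2 : HasDerivAt (fun s : ℝ => (s, (y.2 : RSpace d))) (1, 0) y.1 :=
    (hasDerivAt_id _).prodMk (hasDerivAt_const _ _)
  exact (h.comp_hasDerivAt y.1 h2).deriv

/-- The tangential projection is self-adjoint, so it moves onto v. Identities between gradients then
reduce to the full derivative of φ. -/
theorem inner_cylinderGrad_snd {φ : ℝ × RSpace d → ℝ} {φ' : ℝ × RSpace d →L[ℝ] ℝ} {y : Cylinder d}
    (h : HasFDerivAt φ φ' (y.1, (y.2 : RSpace d))) (v : RSpace d) :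
    inner ℝ (cylinderGrad φ y).snd v =
      φ' (0, v - (inner ℝ (y.2 : RSpace d) v : ℝ) • (y.2 : RSpace d)) := by
  have h2 : HasFDerivAt (fun x : RSpace d => φ (y.1, x))
      (φ'.comp (ContinuousLinearMap.inr ℝ ℝ (RSpace d))) (y.2 : RSpace d) :=
    h.comp (y.2 : RSpace d) (hasFDerivAt_prodMk_right _ _)
  have key : ∀ v : RSpace d,
      inner ℝ (gradient (fun x : RSpace d => φ (y.1, x)) y.2) v = φ' (0, v) := by
    intro v
    rw [inner_gradient, h2.fderiv]; simp
  have e : φ' (0, v - (inner ℝ (y.2 : RSpace d) v : ℝ) • (y.2 : RSpace d)) =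
      φ' (0, v) - inner ℝ (y.2 : RSpace d) v * φ' (0, (y.2 : RSpace d)) := by
    rw [← smul_eq_mul, ← map_smul, ← map_sub]; simp
  rw [e, ← key, ← key]
  simp only [cylinderGrad, WithLp.toLp_snd, inner_sub_left, inner_smul_left]
  simp [mul_comm]

theorem cylinderGrad_ext {G G' : WithLp 2 (ℝ × RSpace d)} (h1 : G.fst = G'.fst)
    (h2 : ∀ v, inner ℝ G.snd v = inner ℝ G'.snd v) : G = G' := by
  have h3 : G.snd = G'.snd := ext_inner_right ℝ h2
  rw [← WithLp.toLp_ofLp 2 G, ← WithLp.toLp_ofLp 2 G']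
  exact congrArg _ (Prod.ext h1 h3)

theorem inner_cylinderGrad_self {φ : ℝ × RSpace d → ℝ} {y : Cylinder d} :
    inner ℝ (cylinderGrad φ y).snd (y.2 : RSpace d) = 0 :=
  inner_proj (norm_sphere y.2) _

theorem cylinderGrad_mul {φ ψ : ℝ × RSpace d → ℝ} {y : Cylinder d}
    (hφ : DifferentiableAt ℝ φ (y.1, (y.2 : RSpace d)))
    (hψ : DifferentiableAt ℝ ψ (y.1, (y.2 : RSpace d))) :
    cylinderGrad (fun p => φ p * ψ p) y =
      cylinderRestrict φ y • cylinderGrad ψ y + cylinderRestrict ψ y • cylinderGrad φ y := by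
  have h := hφ.hasFDerivAt.fun_mul hψ.hasFDerivAt
  refine cylinderGrad_ext ?_ fun v => ?_
  · rw [cylinderGrad_fst h, WithLp.add_fst, WithLp.smul_fst, WithLp.smul_fst,
      cylinderGrad_fst hφ.hasFDerivAt, cylinderGrad_fst hψ.hasFDerivAt]
    rfl
  · rw [inner_cylinderGrad_snd h, WithLp.add_snd, WithLp.smul_snd, WithLp.smul_snd, inner_add_left,
      inner_smul_left, inner_smul_left, inner_cylinderGrad_snd hφ.hasFDerivAt,
      inner_cylinderGrad_snd hψ.hasFDerivAt]
    rfl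

theorem hasFDerivAt_comp_fst {χ : ℝ → ℝ} {χ' : ℝ} {p : ℝ × RSpace d} (h : HasDerivAt χ χ' p.1) :
    HasFDerivAt (fun q : ℝ × RSpace d => χ q.1) (χ' • ContinuousLinearMap.fst ℝ ℝ (RSpace d)) p :=
  HasDerivAt.comp_hasFDerivAt (h₂ := χ) (f := fun q : ℝ × RSpace d => q.1) p h hasFDerivAt_fst

theorem cylinderGrad_comp_fst {χ : ℝ → ℝ} {y : Cylinder d} (hχ : DifferentiableAt ℝ χ y.1) :
    cylinderGrad (fun p : ℝ × RSpace d => χ p.1) y = WithLp.toLp 2 (deriv χ y.1, 0) := by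
  have h : HasFDerivAt (fun p : ℝ × RSpace d => χ p.1) _ (y.1, (y.2 : RSpace d)) :=
    hasFDerivAt_comp_fst hχ.hasDerivAt
  refine cylinderGrad_ext ?_ fun v => ?_
  · rw [cylinderGrad_fst h]; simp
  · rw [inner_cylinderGrad_snd h]; simp

/-- The function `e^{αs} φ(e^s x)` on `ℝ × ℝ^d`. -/
def spacePullback (α : ℝ) (φ : RSpace d → ℝ) (p : ℝ × RSpace d) : ℝ :=
  Real.exp (α * p.1) * φ (Real.exp p.1 • p.2)

theorem contDiff_spacePullback (α : ℝ) {φ : RSpace d → ℝ} (hφ : ContDiff ℝ ∞ φ) :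
    ContDiff ℝ ∞ (spacePullback α φ) := by
  unfold spacePullback
  fun_prop

theorem cylinderGrad_spacePullback (α : ℝ) {φ : RSpace d → ℝ} (y : Cylinder d)
    (hφ : DifferentiableAt ℝ φ (logPolar d y)) :
    cylinderGrad (spacePullback α φ) y = spaceToCyl α y.2 (Real.exp (α * y.1) * φ (logPolar d y))
      (Real.exp ((α + 1) * y.1) • gradient φ (logPolar d y)) := by
  have h1 : HasFDerivAt (fun p : ℝ × RSpace d => Real.exp p.1 • p.2) _ (y.1, (y.2 : RSpace d)) :=
    (hasFDerivAt_comp_fst (Real.hasDerivAt_exp y.1)).fun_smul hasFDerivAt_snd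
  have h2 : HasFDerivAt (fun p : ℝ × RSpace d => φ (Real.exp p.1 • p.2)) _ (y.1, (y.2 : RSpace d)) :=
    HasFDerivAt.comp (y.1, (y.2 : RSpace d)) (g := φ) hφ.hasFDerivAt h1
  have h3 : HasFDerivAt (fun p : ℝ × RSpace d => Real.exp (α * p.1)) _ (y.1, (y.2 : RSpace d)) :=
    hasFDerivAt_comp_fst (χ := fun s => Real.exp (α * s)) ((hasDerivAt_id' y.1).const_mul α).exp
  have h : HasFDerivAt (spacePullback α φ) _ (y.1, (y.2 : RSpace d)) := h3.mul h2
  have hexp : Real.exp ((α + 1) * y.1) = Real.exp (α * y.1) * Real.exp y.1 := by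
    rw [← Real.exp_add]; ring_nf
  refine cylinderGrad_ext ?_ fun v => ?_
  · rw [cylinderGrad_fst h]
    simp only [spaceToCyl, WithLp.toLp_fst, inner_smul_left, inner_gradient, hexp]
    simp [logPolar]
    ring
  · rw [inner_cylinderGrad_snd h]
    simp only [spaceToCyl, WithLp.toLp_snd, inner_smul_left, inner_gradient, hexp, inner_sub_left]
    simp [logPolar]
    ring

/-- The function `|x|^{-α} Φ(log |x|, x / |x|)` on `ℝ^d`. -/
def cylinderPullback (α : ℝ) (Φ : ℝ × RSpace d → ℝ) (x : RSpace d) : ℝ :=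
  ‖x‖ ^ (-α) * Φ (Real.log ‖x‖, ‖x‖⁻¹ • x)

theorem cylinderPullback_logPolar (α : ℝ) (Φ : ℝ × RSpace d → ℝ) (y : Cylinder d) :
    cylinderPullback α Φ (logPolar d y) = Real.exp (-(α * y.1)) * cylinderRestrict Φ y := by
  rw [cylinderPullback, log_norm_logPolar, normalize_logPolar, norm_logPolar, ← Real.exp_mul,
    cylinderRestrict]
  ring_nf

theorem cylinderPullback_eq_zero {α R : ℝ} (hα : α ≠ 0) {Φ : ℝ × RSpace d → ℝ}
    (hR : ∀ s x, R ≤ |s| → Φ (s, x) = 0) {x : RSpace d} (hx : ‖x‖ ≤ Real.exp (-R)) :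
    cylinderPullback α Φ x = 0 := by
  rw [cylinderPullback]
  rcases eq_or_ne x 0 with rfl | h0
  -- At the origin the default values of log and inverse evaluate Φ at (0, 0), where it need not
  -- vanish; it is the factor `0 ^ (-α)` that is 0, because α ≠ 0.
  · rw [norm_zero, Real.zero_rpow (neg_ne_zero.2 hα), zero_mul]
  · rw [hR, mul_zero]
    have := (Real.log_le_iff_le_exp (norm_pos_iff.2 h0)).2 hx
    exact (le_neg.1 this).trans (neg_le_abs _)

/-- Vanishing for s ≤ -R means vanishing near the origin, which gives smoothness there and the
condition at 0 in every dimension; vanishing for s ≥ R gives compact support. -/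
theorem isHardyTest_cylinderPullback {α R : ℝ} (hα : α ≠ 0) {Φ : ℝ × RSpace d → ℝ}
    (hΦ : ContDiff ℝ ∞ Φ) (hR : ∀ s x, R ≤ |s| → Φ (s, x) = 0) :
    IsHardyTest d (cylinderPullback α Φ) := by
  have hev : cylinderPullback α Φ =ᶠ[𝓝 (0 : RSpace d)] 0 := by
    filter_upwards [Metric.ball_mem_nhds (0 : RSpace d) (Real.exp_pos (-R))] with x hx
    exact cylinderPullback_eq_zero hα hR (mem_ball_zero_iff.1 hx).le
  refine ⟨?_, ?_, fun _ => ?_, fun _ => ?_⟩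
  · rw [contDiff_iff_contDiffAt]
    intro x
    rcases eq_or_ne x 0 with rfl | h0
    · exact contDiffAt_const.congr_of_eventuallyEq hev
    · have hn : ‖x‖ ≠ 0 := norm_ne_zero_iff.2 h0
      have h1 : ContDiffAt ℝ ∞ (fun x : RSpace d => ‖x‖) x := contDiffAt_id.norm ℝ h0
      exact (h1.rpow_const_of_ne hn).mul
        (hΦ.contDiffAt.comp x ((h1.log hn).prodMk ((h1.inv hn).smul contDiffAt_id)))
  · refine HasCompactSupport.intro (isCompact_closedBall (0 : RSpace d) (Real.exp R)) fun x hx => ?_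
    rw [mem_closedBall_zero_iff, not_le] at hx
    rw [cylinderPullback, hR, mul_zero]
    have h0 : 0 < ‖x‖ := (Real.exp_pos _).trans hx
    exact ((Real.le_log_iff_exp_le h0).2 hx.le).trans (le_abs_self _)
  · rw [hev.fderiv_eq]; simp
  · rwa [notMem_tsupport_iff_eventuallyEq]

theorem gradient_cylinderPullback (α : ℝ) {Φ : ℝ × RSpace d → ℝ} (hΦ : Differentiable ℝ Φ)
    (y : Cylinder d) : gradient (cylinderPullback α Φ) (logPolar d y) =
      Real.exp (-((α + 1) * y.1)) •
        cylToSpace α y.2 (cylinderRestrict Φ y) (cylinderGrad Φ y) := by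
  set x := logPolar d y with hx
  have hx0 : x ≠ 0 := logPolar_ne_zero y
  have hn : ‖x‖ ≠ 0 := norm_ne_zero_iff.2 hx0
  -- This is log ‖z‖, written through the squared norm, whose derivative is explicit.
  let L : RSpace d → ℝ := fun z => Real.log (‖z‖ ^ 2) / 2
  have hL : ∀ z : RSpace d, L z = Real.log ‖z‖ := fun z => by
    simp only [L, Real.log_pow]; push_cast; ring
  have hLx : L x = y.1 := by rw [hL, hx, log_norm_logPolar]
  have hev : cylinderPullback α Φ =ᶠ[𝓝 x]
      fun z => Real.exp (-α * L z) * Φ (L z, Real.exp (-L z) • z) := by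
    filter_upwards [isOpen_ne.mem_nhds hx0] with z hz
    have hz0 : 0 < ‖z‖ := norm_pos_iff.2 hz
    rw [cylinderPullback, hL, Real.exp_neg, Real.exp_log hz0, Real.rpow_def_of_pos hz0]
    ring_nf
  have h1 : HasFDerivAt L (Real.exp (-y.1) • innerSL ℝ (y.2 : RSpace d)) x := by
    have := (((hasStrictFDerivAt_norm_sq x).hasFDerivAt.log (pow_ne_zero 2 hn)).mul_const
      (2⁻¹ : ℝ))
    refine this.congr_fderiv ?_
    ext v
    simp only [hx, norm_logPolar]
    simp [logPolar, Real.exp_neg]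
    field_simp
  have h2 : HasFDerivAt (fun z => Real.exp (-α * L z)) _ x := (h1.const_mul (-α)).exp
  have h3 : HasFDerivAt (fun z => Real.exp (-L z) • z) _ x := (h1.neg.exp).smul (hasFDerivAt_id x)
  have h4 := (hΦ (L x, Real.exp (-L x) • x)).hasFDerivAt.comp x (h1.prodMk h3)
  have h5 := ((h2.mul h4).congr_of_eventuallyEq hev)
  have hex : Real.exp (-y.1) • x = (y.2 : RSpace d) := by
    rw [← normalize_logPolar y, norm_logPolar, Real.exp_neg]
  have hex1 : Real.exp (-((α + 1) * y.1)) = Real.exp (-α * y.1) * Real.exp (-y.1) := by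
    rw [← Real.exp_add]; ring_nf
  have hp : (L x, Real.exp (-L x) • x) = (y.1, (y.2 : RSpace d)) := by rw [hLx, hex]
  rw [hp] at h5
  refine ext_inner_right ℝ fun v => ?_
  rw [inner_gradient, h5.fderiv, inner_smul_left, cylToSpace, inner_add_left, inner_smul_left,
    inner_cylinderGrad_self, zero_smul, sub_zero,
    inner_cylinderGrad_snd (hΦ (y.1, (y.2 : RSpace d))).hasFDerivAt,
    cylinderGrad_fst (hΦ (y.1, (y.2 : RSpace d))).hasFDerivAt, hex1]
  set D := fderiv ℝ Φ (y.1, (y.2 : RSpace d))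
  set c : ℝ := inner ℝ (y.2 : RSpace d) v with hc
  have hD : ∀ (t : ℝ) (k : RSpace d), D (t, k) = t * D (1, 0) + D (0, k) := fun t k => by
    rw [← smul_eq_mul, ← map_smul, ← map_add]; simp
  have hv : ∀ t : ℝ, D (0, t • (v - c • (y.2 : RSpace d))) = t * D (0, v - c • (y.2 : RSpace d)) :=
    fun t => by rw [← smul_eq_mul, ← map_smul]; simp
  have e1 : Real.exp (-y.1) • v +
      -((Real.exp (-y.1) * (Real.exp (-y.1) * c)) • x) =
      Real.exp (-y.1) • (v - c • (y.2 : RSpace d)) := by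
    rw [← hex]; module
  simp [hLx]
  rw [hex, hD, ← hc, e1, hv, cylinderRestrict]
  ring

end gradient

/-! ### Convergence in L². -/

section L2
variable {X : Type*} [MeasurableSpace X] {μ : Measure X}
  {E F H : Type*} [NormedAddCommGroup E] [NormedAddCommGroup F] [NormedAddCommGroup H]

theorem tendsto_integral_mul_of_L2 {f g : X → ℝ} {u v : ℕ → X → ℝ} (hf : MemLp f 2 μ)
    (hg : MemLp g 2 μ) (hu : ∀ n, MemLp (u n) 2 μ) (hv : ∀ n, MemLp (v n) 2 μ)
    (huf : Tendsto (fun n => eLpNorm (fun x => u n x - f x) 2 μ) atTop (𝓝 0))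
    (hvg : Tendsto (fun n => eLpNorm (fun x => v n x - g x) 2 μ) atTop (𝓝 0)) :
    Tendsto (fun n => ∫ x, u n x * v n x ∂μ) atTop (𝓝 (∫ x, f x * g x ∂μ)) := by
  have key : ∀ {a b : X → ℝ} (ha : MemLp a 2 μ) (hb : MemLp b 2 μ),
      ∫ x, a x * b x ∂μ = inner ℝ (ha.toLp a) (hb.toLp b) := by
    intro a b ha hb
    rw [L2.inner_def]
    refine integral_congr_ae ?_
    filter_upwards [ha.coeFn_toLp, hb.coeFn_toLp] with x h1 h2
    rw [h1, h2]
    simp [mul_comm]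
  rw [key hf hg]
  simp only [key (hu _) (hv _)]
  exact ((Lp.tendsto_Lp_iff_tendsto_eLpNorm'' u hu f hf).2 huf).inner
    ((Lp.tendsto_Lp_iff_tendsto_eLpNorm'' v hv g hg).2 hvg)

theorem eLpNorm_le_of_norm_le {u : X → E} {f : X → F} {g : X → H} {a b : ℝ} (ha : 0 ≤ a)
    (hb : 0 ≤ b) (hf : AEStronglyMeasurable f μ) (hg : AEStronglyMeasurable g μ)
    (h : ∀ x, ‖u x‖ ≤ a * ‖f x‖ + b * ‖g x‖) :
    eLpNorm u 2 μ ≤ ENNReal.ofReal a * eLpNorm f 2 μ + ENNReal.ofReal b * eLpNorm g 2 μ := by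
  have h1 : ∀ (c : ℝ) (hc : 0 ≤ c), ENNReal.ofReal c = ‖c‖ₑ := fun c hc => by
    rw [Real.enorm_eq_ofReal hc]
  rw [← eLpNorm_norm f, ← eLpNorm_norm g, h1 a ha, h1 b hb, ← eLpNorm_const_smul,
    ← eLpNorm_const_smul]
  exact (eLpNorm_mono_real h).trans
    (eLpNorm_add_le (hf.norm.const_smul a) (hg.norm.const_smul b) (by norm_num))

theorem memLp_of_norm_le {u : X → E} {f : X → F} {g : X → H} {a b : ℝ}
    (hu : AEStronglyMeasurable u μ) (hf : MemLp f 2 μ) (hg : MemLp g 2 μ)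
    (h : ∀ x, ‖u x‖ ≤ a * ‖f x‖ + b * ‖g x‖) : MemLp u 2 μ :=
  MemLp.mono' ((hf.norm.const_mul a).add (hg.norm.const_mul b)) hu (ae_of_all _ h)

theorem tendsto_eLpNorm_of_norm_le {u : ℕ → X → E} {f : ℕ → X → F} {g : ℕ → X → H} {a b : ℝ}
    (ha : 0 ≤ a) (hb : 0 ≤ b) (hf : ∀ n, AEStronglyMeasurable (f n) μ)
    (hg : ∀ n, AEStronglyMeasurable (g n) μ)
    (h : ∀ n x, ‖u n x‖ ≤ a * ‖f n x‖ + b * ‖g n x‖)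
    (hf0 : Tendsto (fun n => eLpNorm (f n) 2 μ) atTop (𝓝 0))
    (hg0 : Tendsto (fun n => eLpNorm (g n) 2 μ) atTop (𝓝 0)) :
    Tendsto (fun n => eLpNorm (u n) 2 μ) atTop (𝓝 0) := by
  have h1 := (ENNReal.Tendsto.const_mul (a := ENNReal.ofReal a) hf0 (Or.inr (by simp))).add
    (ENNReal.Tendsto.const_mul (a := ENNReal.ofReal b) hg0 (Or.inr (by simp)))
  simp only [mul_zero, add_zero] at h1
  exact tendsto_of_tendsto_of_tendsto_of_le_of_le tendsto_const_nhds h1 (fun _ => zero_le)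
    fun n => eLpNorm_le_of_norm_le ha hb (hf n) (hg n) (h n)

theorem tendsto_eLpNorm_of_dominated {u : ℕ → X → E} {B : X → ℝ} (hB : MemLp B 2 μ)
    (hu : ∀ n, AEStronglyMeasurable (u n) μ) (h : ∀ n x, ‖u n x‖ ≤ B x)
    (h0 : ∀ x, Tendsto (fun n => u n x) atTop (𝓝 0)) :
    Tendsto (fun n => eLpNorm (u n) 2 μ) atTop (𝓝 0) := by
  have h1 : Tendsto (fun n => ∫⁻ x, ‖u n x‖ₑ ^ 2 ∂μ) atTop (𝓝 (∫⁻ _, 0 ∂μ)) := by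
    refine tendsto_lintegral_of_dominated_convergence' (fun x => ‖B x‖ₑ ^ 2)
      (fun n => (hu n).enorm.pow_const 2) (fun n => ae_of_all _ fun x => ?_) ?_
      (ae_of_all _ fun x => ?_)
    · refine pow_le_pow_left' (enorm_le_iff_norm_le.2 ?_) 2
      exact (h n x).trans (le_abs_self _)
    · have := hB.eLpNorm_lt_top
      rw [eLpNorm_lt_top_iff_lintegral_rpow_enorm_lt_top (by simp) (by simp)] at this
      simpa using this.ne
    · simpa using ENNReal.Tendsto.pow (n := 2) (h0 x).enorm
  have h2 := h1.ennrpow_const (1 / 2)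
  simp only [lintegral_zero] at h2
  rw [ENNReal.zero_rpow_of_pos (by norm_num)] at h2
  refine h2.congr fun n => ?_
  rw [eLpNorm_eq_lintegral_rpow_enorm_toReal (by simp) (by simp)]
  simp

end L2

/-! ### Truncation in s and the energy identity in H¹(𝒞). -/

/-- Dilates of a single bump function. The decay of χₙ' comes from scaling and removes the term χₙ'Φ
in the gradient of χₙΦ. -/
theorem exists_cutoff : ∃ χ : ℕ → ℝ → ℝ, (∀ n, ContDiff ℝ ∞ (χ n)) ∧
    (∀ n s, 0 ≤ χ n s ∧ χ n s ≤ 1) ∧ (∀ n, ∃ R, ∀ s, R ≤ |s| → χ n s = 0) ∧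
    (∃ C, 0 ≤ C ∧ ∀ n s, |deriv (χ n) s| ≤ C / (n + 1)) ∧ ∀ s, ∀ᶠ n in atTop, χ n s = 1 := by
  let b : ContDiffBump (0 : ℝ) := ⟨1, 2, one_pos, one_lt_two⟩
  have hn : ∀ n : ℕ, (0 : ℝ) < n + 1 := fun n => by positivity
  obtain ⟨C, hC⟩ := b.hasCompactSupport.deriv.exists_bound_of_continuous
    ((b.contDiff (n := 1)).continuous_deriv le_rfl)
  refine ⟨fun n s => b ((n + 1 : ℝ)⁻¹ * s), fun n => b.contDiff.comp (contDiff_const.mul contDiff_id),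
    fun n s => ⟨b.nonneg, b.le_one⟩, fun n => ⟨2 * (n + 1), fun s hs => ?_⟩,
    ⟨C, (norm_nonneg _).trans (hC 0), fun n s => ?_⟩, fun s => ?_⟩
  · apply b.zero_of_le_dist
    rw [dist_zero_right, Real.norm_eq_abs, abs_mul, abs_inv, abs_of_pos (hn n)]
    rw [← div_eq_inv_mul, le_div_iff₀ (hn n)]
    exact hs
  · have h := ((b.contDiff (n := 1)).differentiable one_ne_zero
      ((n + 1 : ℝ)⁻¹ * s)).hasDerivAt.comp s ((hasDerivAt_id s).const_mul ((n + 1 : ℝ)⁻¹))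
    rw [show deriv (fun s => b ((n + 1 : ℝ)⁻¹ * s)) s = _ from h.deriv, abs_mul, mul_one, abs_inv,
      abs_of_pos (hn n), ← div_eq_mul_inv]
    have := hn n
    gcongr
    exact hC _
  · obtain ⟨N, hN⟩ := exists_nat_ge |s|
    filter_upwards [eventually_ge_atTop N] with n hnN
    apply b.one_of_mem_closedBall
    rw [mem_closedBall_zero_iff, Real.norm_eq_abs, abs_mul, abs_inv, abs_of_pos (hn n),
      ← div_eq_inv_mul, div_le_one (hn n)]
    have : (N : ℝ) ≤ n := by exact_mod_cast hnN
    linarith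

section H1
variable {d : ℕ}

/-- The sphere is compact, so cutting off in s alone suffices; both errors tend to 0 by dominated
convergence. -/
theorem exists_compactly_supported_approx {Φ : ℝ × RSpace d → ℝ} (hΦ : ContDiff ℝ ∞ Φ)
    (h1 : MemLp (cylinderRestrict Φ) 2 (cylinderMeasure d))
    (h2 : MemLp (cylinderGrad Φ) 2 (cylinderMeasure d)) {ε : ℝ≥0∞} (hε : 0 < ε) :
    ∃ Ψ : ℝ × RSpace d → ℝ, ContDiff ℝ ∞ Ψ ∧ (∃ R, ∀ s x, R ≤ |s| → Ψ (s, x) = 0) ∧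
      MemLp (cylinderRestrict Ψ) 2 (cylinderMeasure d) ∧
      MemLp (cylinderGrad Ψ) 2 (cylinderMeasure d) ∧
      eLpNorm (fun y => cylinderRestrict Ψ y - cylinderRestrict Φ y) 2 (cylinderMeasure d) ≤ ε ∧
      eLpNorm (fun y => cylinderGrad Ψ y - cylinderGrad Φ y) 2 (cylinderMeasure d) ≤ ε := by
  obtain ⟨χ, hχ, hχ01, hχR, ⟨C, hC0, hC⟩, hχ1⟩ := exists_cutoff
  let Ψ : ℕ → ℝ × RSpace d → ℝ := fun n p => χ n p.1 * Φ p
  have hΨ : ∀ n, ContDiff ℝ ∞ (Ψ n) := fun n => ((hχ n).comp contDiff_fst).mul hΦ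
  have hgrad : ∀ n y, cylinderGrad (Ψ n) y = χ n y.1 • cylinderGrad Φ y +
      cylinderRestrict Φ y • WithLp.toLp 2 (deriv (χ n) y.1, (0 : RSpace d)) := by
    intro n y
    have hd : DifferentiableAt ℝ (χ n) y.1 := (hχ n).differentiable (by simp) _
    rw [← cylinderGrad_comp_fst hd]
    exact cylinderGrad_mul (φ := fun p => χ n p.1) (hd.comp (y.1, (y.2 : RSpace d)) differentiableAt_fst)
      (hΦ.differentiable (by simp) _)
  have hm : ∀ n, AEStronglyMeasurable (fun y : Cylinder d => χ n y.1) (cylinderMeasure d) :=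
    fun n => ((hχ n).continuous.comp continuous_fst).aestronglyMeasurable
  have hm' : ∀ n, AEStronglyMeasurable (fun y : Cylinder d =>
      WithLp.toLp 2 (deriv (χ n) y.1, (0 : RSpace d))) (cylinderMeasure d) := by
    intro n
    have h1 : Continuous (deriv (χ n)) := (hχ n).continuous_deriv (by simp)
    exact ((WithLp.prod_continuous_toLp 2 ℝ (RSpace d)).comp
      ((h1.comp continuous_fst).prodMk continuous_const)).aestronglyMeasurable
  have hmΨ : ∀ n, AEStronglyMeasurable (cylinderRestrict (Ψ n)) (cylinderMeasure d) :=
    fun n => (hm n).mul h1.1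
  have hmG : ∀ n, AEStronglyMeasurable (cylinderGrad (Ψ n)) (cylinderMeasure d) := by
    intro n
    rw [funext (hgrad n)]
    exact ((hm n).smul h2.1).add (h1.1.smul (hm' n))
  have habs : ∀ n s, |χ n s - 1| ≤ 1 := fun n s => by
    rw [abs_le]; constructor <;> linarith [(hχ01 n s).1, (hχ01 n s).2]
  have hto : ∀ s, Tendsto (fun n => χ n s) atTop (𝓝 1) := fun s =>
    tendsto_const_nhds.congr' ((hχ1 s).mono fun n h => h.symm)
  have hC1 : ∀ n : ℕ, C / (n + 1) ≤ C := fun n =>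
    div_le_self hC0 (by linarith [(Nat.cast_nonneg n : (0 : ℝ) ≤ n)])
  have hdto : ∀ s, Tendsto (fun n => deriv (χ n) s) atTop (𝓝 0) := fun s =>
    squeeze_zero_norm (fun n => hC n s) (by
      simpa [div_eq_mul_inv] using tendsto_one_div_add_atTop_nhds_zero_nat.const_mul C)
  have hd : ∀ n y, cylinderGrad (Ψ n) y - cylinderGrad Φ y = (χ n y.1 - 1) • cylinderGrad Φ y +
      cylinderRestrict Φ y • WithLp.toLp 2 (deriv (χ n) y.1, (0 : RSpace d)) := fun n y => by
    rw [hgrad]; module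
  have hd' : ∀ n y, cylinderRestrict (Ψ n) y - cylinderRestrict Φ y =
      (χ n y.1 - 1) * cylinderRestrict Φ y := fun n y => by
    simp only [cylinderRestrict, Ψ]; ring
  have t1 : Tendsto (fun n => eLpNorm (fun y => cylinderRestrict (Ψ n) y - cylinderRestrict Φ y) 2
      (cylinderMeasure d)) atTop (𝓝 0) := by
    refine tendsto_eLpNorm_of_dominated h1.norm (fun n => (hmΨ n).sub h1.1) (fun n y => ?_) fun y => ?_
    · rw [hd', norm_mul]
      exact mul_le_of_le_one_left (norm_nonneg _) (habs _ _)
    · simp only [hd']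
      simpa using ((hto y.1).sub_const 1).mul_const (cylinderRestrict Φ y)
  have t2 : Tendsto (fun n => eLpNorm (fun y => cylinderGrad (Ψ n) y - cylinderGrad Φ y) 2
      (cylinderMeasure d)) atTop (𝓝 0) := by
    refine tendsto_eLpNorm_of_dominated (h2.norm.add (h1.norm.const_mul C))
      (fun n => (hmG n).sub h2.1) (fun n y => ?_) fun y => ?_
    · rw [hd]
      refine (norm_add_le _ _).trans (add_le_add ?_ ?_)
      · rw [norm_smul]
        exact mul_le_of_le_one_left (norm_nonneg _) (habs _ _)
      · rw [norm_smul, mul_comm, WithLp.norm_toLp_fst]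
        exact mul_le_mul_of_nonneg_right ((hC _ _).trans (hC1 n)) (norm_nonneg _)
    · simp only [hd]
      have c1 : Tendsto (fun n => WithLp.toLp 2 (deriv (χ n) y.1, (0 : RSpace d))) atTop (𝓝 0) := by
        rw [tendsto_zero_iff_norm_tendsto_zero]
        simp only [WithLp.norm_toLp_fst]
        simpa using (hdto y.1).norm
      simpa using (((hto y.1).sub_const 1).smul_const (cylinderGrad Φ y)).add
        (c1.const_smul (cylinderRestrict Φ y))
  obtain ⟨n, hn1, hn2⟩ := ((t1.eventually_le_const hε).and (t2.eventually_le_const hε)).exists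
  obtain ⟨R, hR⟩ := hχR n
  refine ⟨Ψ n, hΨ n, ⟨R, fun s x hs => ?_⟩, ?_, ?_, hn1, hn2⟩
  · simp only [Ψ, hR s hs, zero_mul]
  · refine h1.mono (hmΨ n) (ae_of_all _ fun y => ?_)
    simp only [cylinderRestrict, Ψ, norm_mul]
    refine mul_le_of_le_one_left (norm_nonneg _) ?_
    rw [Real.norm_eq_abs, abs_of_nonneg (hχ01 _ _).1]; exact (hχ01 _ _).2
  · refine memLp_of_norm_le (a := 1) (b := C) (hmG n) h2 h1 fun y => ?_
    rw [hgrad]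
    refine (norm_add_le _ _).trans (add_le_add ?_ ?_)
    · rw [norm_smul]
      gcongr
      rw [Real.norm_eq_abs, abs_of_nonneg (hχ01 _ _).1]; exact (hχ01 _ _).2
    · rw [norm_smul, mul_comm, WithLp.norm_toLp_fst]
      gcongr
      exact (hC _ _).trans (hC1 n)

/-- Only truncated approximants become test functions on ℝ^d. The n-th one is truncated with error
at most 1/(n+1). -/
theorem IsH1Cylinder.exists_compactly_supported {w : Cylinder d → ℝ}
    {G : Cylinder d → WithLp 2 (ℝ × RSpace d)} (h : IsH1Cylinder d w G) :
    ∃ Ψ : ℕ → ℝ × RSpace d → ℝ, (∀ n, ContDiff ℝ ∞ (Ψ n) ∧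
      (∃ R, ∀ s x, R ≤ |s| → Ψ n (s, x) = 0) ∧
      MemLp (cylinderRestrict (Ψ n)) 2 (cylinderMeasure d) ∧
      MemLp (cylinderGrad (Ψ n)) 2 (cylinderMeasure d)) ∧
      Tendsto (fun n => eLpNorm (fun y => cylinderRestrict (Ψ n) y - w y) 2 (cylinderMeasure d))
        atTop (𝓝 0) ∧
      Tendsto (fun n => eLpNorm (fun y => cylinderGrad (Ψ n) y - G y) 2 (cylinderMeasure d))
        atTop (𝓝 0) := by
  obtain ⟨hw, hG, φ, hφ, t1, t2⟩ := h
  have hpos : ∀ n : ℕ, (0 : ℝ≥0∞) < ((n : ℝ≥0∞) + 1)⁻¹ := fun n => by simp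
  choose Ψ hΨ hR m1 m2 e1 e2 using fun n =>
    exists_compactly_supported_approx (hφ n).1 (hφ n).2.1 (hφ n).2.2 (hpos n)
  have hto : Tendsto (fun n : ℕ => ((n : ℝ≥0∞) + 1)⁻¹) atTop (𝓝 0) := by
    have := ENNReal.tendsto_inv_nat_nhds_zero.comp (tendsto_add_atTop_nat 1)
    refine this.congr fun n => ?_
    simp
  refine ⟨Ψ, fun n => ⟨hΨ n, hR n, m1 n, m2 n⟩, ?_, ?_⟩
  · have := hto.add t1
    rw [add_zero] at this
    refine tendsto_of_tendsto_of_tendsto_of_le_of_le tendsto_const_nhds this (fun _ => zero_le)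
      fun n => ?_
    refine le_trans ?_ (add_le_add_left (e1 n) _)
    refine le_trans (le_of_eq ?_) (eLpNorm_add_le ((m1 n).1.sub (hφ n).2.1.1)
      ((hφ n).2.1.1.sub hw.1) (by norm_num))
    congr 1; ext y; simp
  · have := hto.add t2
    rw [add_zero] at this
    refine tendsto_of_tendsto_of_tendsto_of_le_of_le tendsto_const_nhds this (fun _ => zero_le)
      fun n => ?_
    refine le_trans ?_ (add_le_add_left (e2 n) _)
    refine le_trans (le_of_eq ?_) (eLpNorm_add_le ((m2 n).1.sub (hφ n).2.2.1)
      ((hφ n).2.2.1.sub hG.1) (by norm_num))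
    congr 1; ext y; simp

theorem memLp_fst {G : Cylinder d → WithLp 2 (ℝ × RSpace d)} (hG : MemLp G 2 (cylinderMeasure d)) :
    MemLp (fun y => (G y).fst) 2 (cylinderMeasure d) :=
  hG.mono ((WithLp.continuous_fst 2 ℝ (RSpace d)).comp_aestronglyMeasurable hG.1)
    (ae_of_all _ fun _ => WithLp.norm_fst_le _ _)

/-- On almost every line θ = const, φ² and its derivative 2φ ∂_s φ are integrable, so the latter has
integral 0. -/
theorem integral_mul_cylinderGrad_fst {φ : ℝ × RSpace d → ℝ} (hφ : ContDiff ℝ ∞ φ)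
    (h1 : MemLp (cylinderRestrict φ) 2 (cylinderMeasure d))
    (h2 : MemLp (cylinderGrad φ) 2 (cylinderMeasure d)) :
    ∫ y, cylinderRestrict φ y * (cylinderGrad φ y).fst ∂(cylinderMeasure d) = 0 := by
  have hi : Integrable (fun y => cylinderRestrict φ y * (cylinderGrad φ y).fst)
      (cylinderMeasure d) := h1.integrable_mul (memLp_fst h2)
  have hi2 : Integrable (fun y => cylinderRestrict φ y ^ 2) (cylinderMeasure d) := h1.integrable_sq
  unfold cylinderMeasure at hi hi2 ⊢
  rw [integral_prod_symm _ hi]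
  refine integral_eq_zero_of_ae ?_
  filter_upwards [hi.prod_left_ae, hi2.prod_left_ae] with θ h3 h4
  have hd : ∀ s : ℝ, HasDerivAt (fun s => cylinderRestrict φ (s, θ) ^ 2)
      (2 * (cylinderRestrict φ (s, θ) * (cylinderGrad φ (s, θ)).fst)) s := by
    intro s
    have : HasDerivAt (fun s => cylinderRestrict φ (s, θ)) (cylinderGrad φ (s, θ)).fst s := by
      have hφd : Differentiable ℝ φ := hφ.differentiable (by simp)
      have : DifferentiableAt ℝ (fun s : ℝ => φ (s, (θ : RSpace d))) s := by fun_prop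
      exact this.hasDerivAt
    convert! this.pow 2 using 1
    ring
  have := integral_eq_zero_of_hasDerivAt_of_integrable hd (h3.const_mul 2) h4
  rw [integral_const_mul] at this
  simpa using this

theorem IsH1Cylinder.integral_mul_fst {w : Cylinder d → ℝ}
    {G : Cylinder d → WithLp 2 (ℝ × RSpace d)} (h : IsH1Cylinder d w G) :
    ∫ y, w y * (G y).fst ∂(cylinderMeasure d) = 0 := by
  obtain ⟨hw, hG, φ, hφ, t1, t2⟩ := h
  have t3 : Tendsto (fun n => eLpNorm (fun y => (cylinderGrad (φ n) y).fst - (G y).fst) 2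
      (cylinderMeasure d)) atTop (𝓝 0) :=
    tendsto_of_tendsto_of_tendsto_of_le_of_le tendsto_const_nhds t2 (fun _ => zero_le)
      fun n => eLpNorm_mono fun y => by
        rw [← WithLp.sub_fst]; exact WithLp.norm_fst_le _ _
  have := tendsto_integral_mul_of_L2 hw (memLp_fst hG) (fun n => (hφ n).2.1)
    (fun n => memLp_fst (hφ n).2.2) t1 t3
  simp only [integral_mul_cylinderGrad_fst (hφ _).1 (hφ _).2.1 (hφ _).2.2] at this
  exact tendsto_nhds_unique this tendsto_const_nhds

/-- Tangentiality survives the L² limit: the normal component of G is bounded pointwise by |∇φₙ -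
G|. -/
theorem IsH1Cylinder.inner_snd_eq_zero {w : Cylinder d → ℝ}
    {G : Cylinder d → WithLp 2 (ℝ × RSpace d)} (h : IsH1Cylinder d w G) :
    ∀ᵐ y ∂(cylinderMeasure d), inner ℝ (G y).snd (y.2 : RSpace d) = 0 := by
  obtain ⟨hw, hG, φ, hφ, t1, t2⟩ := h
  have hm : AEStronglyMeasurable (fun y : Cylinder d => inner ℝ (G y).snd (y.2 : RSpace d))
      (cylinderMeasure d) :=
    ((WithLp.continuous_snd 2 ℝ (RSpace d)).comp_aestronglyMeasurable hG.1).inner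
      (continuous_subtype_val.comp continuous_snd).aestronglyMeasurable
  refine (eLpNorm_eq_zero_iff hm (by simp : (2 : ℝ≥0∞) ≠ 0)).1 ?_
  refine le_antisymm (ge_of_tendsto' t2 fun n => eLpNorm_mono fun y => ?_) zero_le
  have e : inner ℝ (G y).snd (y.2 : RSpace d) =
      -inner ℝ (cylinderGrad (φ n) y - G y).snd (y.2 : RSpace d) := by
    rw [WithLp.sub_snd, inner_sub_left, inner_cylinderGrad_self]; ring
  rw [e, norm_neg]
  refine (norm_inner_le_norm _ _).trans ?_
  rw [norm_sphere, mul_one]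
  exact WithLp.norm_snd_le _ _

theorem IsH1Cylinder.integral_norm_sq_cylToSpace {w : Cylinder d → ℝ}
    {G : Cylinder d → WithLp 2 (ℝ × RSpace d)} (h : IsH1Cylinder d w G) (α : ℝ) :
    ∫ y, ‖cylToSpace α (y.2 : RSpace d) (w y) (G y)‖ ^ 2 ∂(cylinderMeasure d) =
      ∫ y, ‖G y‖ ^ 2 ∂(cylinderMeasure d) + α ^ 2 * ∫ y, w y ^ 2 ∂(cylinderMeasure d) := by
  have i1 : Integrable (fun y => ‖G y‖ ^ 2) (cylinderMeasure d) := h.2.1.norm.integrable_sq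
  have i2 : Integrable (fun y => α ^ 2 * w y ^ 2) (cylinderMeasure d) :=
    h.1.integrable_sq.const_mul _
  have i3 : Integrable (fun y => 2 * α * (w y * (G y).fst)) (cylinderMeasure d) :=
    (h.1.integrable_mul (memLp_fst h.2.1)).const_mul (2 * α)
  have e : (fun y => ‖cylToSpace α (y.2 : RSpace d) (w y) (G y)‖ ^ 2) =ᵐ[cylinderMeasure d]
      fun y => ‖G y‖ ^ 2 + α ^ 2 * w y ^ 2 - 2 * α * (w y * (G y).fst) := by
    filter_upwards [h.inner_snd_eq_zero] with y hy
    exact norm_sq_cylToSpace α (norm_sphere y.2) _ hy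
  rw [integral_congr_ae e, integral_sub (by exact i1.add i2) i3, integral_add i1 i2, integral_const_mul,
    integral_const_mul, h.integral_mul_fst]
  ring

end H1

/-! ### Equivalence of the weighted and the cylinder inequality. -/

section correspondence
variable {d : ℕ}

theorem continuous_spaceToCyl (α : ℝ) : Continuous fun p : RSpace d × ℝ × RSpace d =>
    spaceToCyl α p.1 p.2.1 p.2.2 := by
  unfold spaceToCyl
  refine (WithLp.prod_continuous_toLp 2 ℝ (RSpace d)).comp ?_
  fun_prop

theorem aestronglyMeasurable_cylToSpace {α : ℝ} {w : Cylinder d → ℝ}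
    {G : Cylinder d → WithLp 2 (ℝ × RSpace d)} (hw : AEStronglyMeasurable w (cylinderMeasure d))
    (hG : AEStronglyMeasurable G (cylinderMeasure d)) :
    AEStronglyMeasurable (fun y => cylToSpace α (y.2 : RSpace d) (w y) (G y))
      (cylinderMeasure d) := by
  have hθ : AEStronglyMeasurable (fun y : Cylinder d => (y.2 : RSpace d)) (cylinderMeasure d) :=
    (continuous_subtype_val.comp continuous_snd).aestronglyMeasurable
  have h1 := (WithLp.continuous_fst 2 ℝ (RSpace d)).comp_aestronglyMeasurable hG
  have h2 := (WithLp.continuous_snd 2 ℝ (RSpace d)).comp_aestronglyMeasurable hG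
  exact ((h1.sub (hw.const_mul α)).smul hθ).add (h2.sub ((h2.inner (𝕜 := ℝ) hθ).smul hθ))

theorem aestronglyMeasurable_spaceToCyl {α : ℝ} {w : Cylinder d → ℝ}
    {h : Cylinder d → RSpace d} (hw : AEStronglyMeasurable w (cylinderMeasure d))
    (hh : AEStronglyMeasurable h (cylinderMeasure d)) :
    AEStronglyMeasurable (fun y => spaceToCyl α (y.2 : RSpace d) (w y) (h y))
      (cylinderMeasure d) := by
  have hθ : AEStronglyMeasurable (fun y : Cylinder d => (y.2 : RSpace d)) (cylinderMeasure d) :=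
    (continuous_subtype_val.comp continuous_snd).aestronglyMeasurable
  have h := hθ.prodMk (hw.prodMk hh)
  exact Continuous.comp_aestronglyMeasurable (g := fun p : RSpace d × ℝ × RSpace d =>
    spaceToCyl α p.1 p.2.1 p.2.2) (continuous_spaceToCyl α) h

theorem continuous_gradient {φ : RSpace d → ℝ} (hφ : ContDiff ℝ ∞ φ) : Continuous (gradient φ) :=
  (InnerProductSpace.toDual ℝ (RSpace d)).symm.continuous.comp (hφ.continuous_fderiv (by simp))

variable {a α : ℝ}

theorem polarWeight_eq (hα : α = ((d : ℝ) - 2 - 2 * a) / 2) (y : Cylinder d) :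
    polarWeight d (a + 1) y = Real.exp (α * y.1) := by
  rw [polarWeight, hα]; ring_nf

theorem polarWeight_eq' (hα : α = ((d : ℝ) - 2 - 2 * a) / 2) (y : Cylinder d) :
    polarWeight d a y = Real.exp ((α + 1) * y.1) := by
  rw [polarWeight, hα]; ring_nf

theorem memLp_of_tendsto_sub {X E : Type*} [MeasurableSpace X] {μ : Measure X}
    [NormedAddCommGroup E] {f : ℕ → X → E} {g : X → E} (hf : ∀ n, AEStronglyMeasurable (f n) μ)
    (hg : MemLp g 2 μ) (h : Tendsto (fun n => eLpNorm (fun x => f n x - g x) 2 μ) atTop (𝓝 0)) :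
    ∀ᶠ n in atTop, MemLp (f n) 2 μ := by
  filter_upwards [h.eventually_lt_const ENNReal.zero_lt_top] with n hn
  have : MemLp (fun x => f n x - g x) 2 μ := ⟨(hf n).sub hg.1, hn⟩
  have h2 := this.add hg
  rwa [show (fun x => f n x - g x) + g = f n from funext fun x => sub_add_cancel _ _] at h2

theorem IsD12.isH1Cylinder (hd : 1 ≤ d) (hα : α = ((d : ℝ) - 2 - 2 * a) / 2) {u : RSpace d → ℝ}
    {H : RSpace d → RSpace d} (h : IsD12 d a u H) :
    IsH1Cylinder d (fun y => Real.exp (α * y.1) * u (logPolar d y))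
      (fun y => spaceToCyl α (y.2 : RSpace d) (Real.exp (α * y.1) * u (logPolar d y))
        (Real.exp ((α + 1) * y.1) • H (logPolar d y))) := by
  obtain ⟨hu, hH, φ, hφ, t1, t2⟩ := h
  -- Finiteness of the weighted norms of the test functions is read off from the convergence, hence
  -- only for large n; the sequence is shifted by N below.
  have hev := (memLp_of_tendsto_sub (fun n => (hφ n).1.continuous.aestronglyMeasurable) hu t1).and
    (memLp_of_tendsto_sub (fun n => (continuous_gradient (hφ n).1).aestronglyMeasurable) hH t2)
  obtain ⟨N, hN⟩ := eventually_atTop.1 hev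
  have hdif : ∀ n x, DifferentiableAt ℝ (φ n) x := fun n x =>
    (hφ n).1.differentiable (by simp) x
  simp only [memLp_logPolar hd, eLpNorm_logPolar hd, polarWeight_eq hα, polarWeight_eq' hα,
    smul_eq_mul] at hu hH t1 t2 hN
  have hres : ∀ n, cylinderRestrict (spacePullback α (φ n)) =
      fun y => Real.exp (α * y.1) * φ n (logPolar d y) := fun n => rfl
  have hgr : ∀ n, cylinderGrad (spacePullback α (φ n)) = fun y => spaceToCyl α y.2
      (Real.exp (α * y.1) * φ n (logPolar d y))
      (Real.exp ((α + 1) * y.1) • gradient (φ n) (logPolar d y)) := fun n =>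
    funext fun y => cylinderGrad_spacePullback α y (hdif n _)
  have hmem : ∀ {w : Cylinder d → ℝ} {h : Cylinder d → RSpace d}, MemLp w 2 (cylinderMeasure d) →
      MemLp h 2 (cylinderMeasure d) →
      MemLp (fun y => spaceToCyl α (y.2 : RSpace d) (w y) (h y)) 2 (cylinderMeasure d) :=
    fun hw hh => memLp_of_norm_le (aestronglyMeasurable_spaceToCyl hw.1 hh.1) hw hh
      fun y => norm_spaceToCyl_le α (norm_sphere y.2) _ _
  refine ⟨hu, hmem hu hH, fun n => spacePullback α (φ (n + N)), fun n =>
    ⟨contDiff_spacePullback α (hφ _).1, ?_, ?_⟩, ?_, ?_⟩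
  · rw [hres]; exact (hN _ (Nat.le_add_left _ _)).1
  · rw [hgr]; exact hmem (hN _ (Nat.le_add_left _ _)).1 (hN _ (Nat.le_add_left _ _)).2
  · simp only [hres, ← mul_sub]
    exact t1.comp (tendsto_add_atTop_nat N)
  · simp only [hgr, ← spaceToCyl_sub, ← mul_sub, ← smul_sub]
    refine tendsto_eLpNorm_of_norm_le (abs_nonneg α) zero_le_two (fun n => ?_) (fun n => ?_)
      (fun n y => norm_spaceToCyl_le α (norm_sphere y.2) _ _)
      (t1.comp (tendsto_add_atTop_nat N)) (t2.comp (tendsto_add_atTop_nat N))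
    · simp only [mul_sub]
      exact (hN _ (Nat.le_add_left _ _)).1.1.sub hu.1
    · simp only [smul_sub]
      exact (hN _ (Nat.le_add_left _ _)).2.1.sub hH.1

theorem IsH1Cylinder.exists_isD12 (hd : 1 ≤ d) (hα : α = ((d : ℝ) - 2 - 2 * a) / 2) (hα0 : α ≠ 0)
    {w : Cylinder d → ℝ} {G : Cylinder d → WithLp 2 (ℝ × RSpace d)} (h : IsH1Cylinder d w G) :
    ∃ u H, IsD12 d a u H ∧ (∀ y, Real.exp (α * y.1) * u (logPolar d y) = w y) ∧
      ∀ y, Real.exp ((α + 1) * y.1) • H (logPolar d y) =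
        cylToSpace α (y.2 : RSpace d) (w y) (G y) := by
  have : Nonempty (Cylinder d) := by
    have : Nonempty (Fin d) := ⟨⟨0, hd⟩⟩
    obtain ⟨θ, hθ⟩ := NormedSpace.sphere_nonempty (x := (0 : RSpace d)) (r := 1) |>.2 zero_le_one
    exact ⟨(0, ⟨θ, hθ⟩)⟩
  -- Only the origin is missed by `logPolar`. The arbitrary value there is harmless, since all norms
  -- are computed through `logPolar`.
  let S : RSpace d → Cylinder d := Function.invFun (logPolar d)
  have hS : ∀ y, S (logPolar d y) = y := Function.leftInverse_invFun (logPolar_injective d)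
  let u : RSpace d → ℝ := fun x => Real.exp (-(α * (S x).1)) * w (S x)
  let H : RSpace d → RSpace d := fun x => Real.exp (-((α + 1) * (S x).1)) •
    cylToSpace α ((S x).2 : RSpace d) (w (S x)) (G (S x))
  have hu : ∀ y, Real.exp (α * y.1) * u (logPolar d y) = w y := fun y => by
    simp only [u, hS]; rw [← mul_assoc, ← Real.exp_add]; simp
  have hH : ∀ y, Real.exp ((α + 1) * y.1) • H (logPolar d y) =
      cylToSpace α (y.2 : RSpace d) (w y) (G y) := fun y => by
    simp only [H, hS]; rw [smul_smul, ← Real.exp_add]; simp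
  obtain ⟨Ψ, hΨ, t1, t2⟩ := h.exists_compactly_supported
  have hmw := h.1
  have hmG := h.2.1
  have hΨu : ∀ n y, Real.exp (α * y.1) * cylinderPullback α (Ψ n) (logPolar d y) =
      cylinderRestrict (Ψ n) y := fun n y => by
    rw [cylinderPullback_logPolar, ← mul_assoc, ← Real.exp_add]; simp
  have hΨH : ∀ n y, Real.exp ((α + 1) * y.1) • gradient (cylinderPullback α (Ψ n)) (logPolar d y) =
      cylToSpace α y.2 (cylinderRestrict (Ψ n) y) (cylinderGrad (Ψ n) y) := fun n y => by
    rw [gradient_cylinderPullback α ((hΨ n).1.differentiable (by simp)), smul_smul,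
      ← Real.exp_add]
    simp
  refine ⟨u, H, ⟨?_, ?_, fun n => cylinderPullback α (Ψ n), fun n => ?_, ?_, ?_⟩, hu, hH⟩
  · simpa only [memLp_logPolar hd, polarWeight_eq hα, smul_eq_mul, hu] using hmw
  · simp only [memLp_logPolar hd, polarWeight_eq' hα, hH]
    exact memLp_of_norm_le (aestronglyMeasurable_cylToSpace hmw.1 hmG.1) hmw hmG
      fun y => norm_cylToSpace_le α (norm_sphere y.2) _ _
  · obtain ⟨h1, ⟨R, hR⟩, -⟩ := hΨ n
    exact isHardyTest_cylinderPullback hα0 h1 hR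
  · simpa only [eLpNorm_logPolar hd, polarWeight_eq hα, smul_eq_mul, mul_sub, hu, hΨu] using t1
  · simp only [eLpNorm_logPolar hd, polarWeight_eq' hα, smul_sub, hH, hΨH, ← cylToSpace_sub]
    exact tendsto_eLpNorm_of_norm_le (abs_nonneg α) zero_le_two
      (fun n => (hΨ n).2.2.1.1.sub hmw.1) (fun n => (hΨ n).2.2.2.1.sub hmG.1)
      (fun n y => norm_cylToSpace_le α (norm_sphere y.2) _ _) t1 t2

theorem integralLE_logPolar (hd : 1 ≤ d) (b : ℝ) (f : RSpace d → ℝ) (B : ℝ) :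
    IntegralLE (hardyMeasure d b) f B ↔
      IntegralLE (cylinderMeasure d) (fun y => polarWeight d b y ^ 2 * f (logPolar d y)) B := by
  unfold IntegralLE
  simp only [integrable_logPolar hd, integral_logPolar hd, mul_max_of_nonneg _ _ (sq_nonneg _),
    mul_zero]

/-- The Emden-Fowler correspondence of the terms of the two inequalities. -/
theorem logHardy_iff_of_correspondence (hd : 1 ≤ d) (hα : α = ((d : ℝ) - 2 - 2 * a) / 2)
    {u : RSpace d → ℝ} {H : RSpace d → RSpace d} {w : Cylinder d → ℝ}
    {G : Cylinder d → WithLp 2 (ℝ × RSpace d)} (hwG : IsH1Cylinder d w G)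
    (hu : ∀ y, Real.exp (α * y.1) * u (logPolar d y) = w y)
    (hH : ∀ y, Real.exp ((α + 1) * y.1) • H (logPolar d y) =
        cylToSpace α (y.2 : RSpace d) (w y) (G y)) (γ C : ℝ) :
    ((∫ x, u x ^ 2 ∂(hardyMeasure d (a + 1))) = 1 →
      IntegralLE (hardyMeasure d (a + 1))
        (fun x => u x ^ 2 * Real.log (‖x‖ ^ ((d : ℝ) - 2 - 2 * a) * u x ^ 2))
        (2 * γ * Real.log (C * (∫ x, ‖H x‖ ^ 2 ∂(hardyMeasure d a))))) ↔
    ((∫ y, w y ^ 2 ∂(cylinderMeasure d)) = 1 →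
      IntegralLE (cylinderMeasure d) (fun y => w y ^ 2 * Real.log (w y ^ 2))
        (2 * γ * Real.log
          (C * ((∫ y, ‖G y‖ ^ 2 ∂(cylinderMeasure d)) + ((d : ℝ) - 2 - 2 * a) ^ 2 / 4)))) := by
  have e1 : ∫ x, u x ^ 2 ∂(hardyMeasure d (a + 1)) = ∫ y, w y ^ 2 ∂(cylinderMeasure d) := by
    simp only [integral_logPolar hd, polarWeight_eq hα, ← mul_pow, hu]
  have e2 : ∫ x, ‖H x‖ ^ 2 ∂(hardyMeasure d a) =
      ∫ y, ‖G y‖ ^ 2 ∂(cylinderMeasure d) + α ^ 2 * ∫ y, w y ^ 2 ∂(cylinderMeasure d) := by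
    rw [← hwG.integral_norm_sq_cylToSpace, integral_logPolar hd]
    refine integral_congr_ae (ae_of_all _ fun y => ?_)
    simp only [← hH, norm_smul, mul_pow, polarWeight_eq' hα, Real.norm_eq_abs, sq_abs]
  -- The power of ‖x‖ inside the logarithm is e^{2αs}, the same factor as the squared polar weight;
  -- both copies of u² become w².
  have e3 : ∀ y, polarWeight d (a + 1) y ^ 2 * (u (logPolar d y) ^ 2 *
      Real.log (‖logPolar d y‖ ^ ((d : ℝ) - 2 - 2 * a) * u (logPolar d y) ^ 2)) =
      w y ^ 2 * Real.log (w y ^ 2) := fun y => by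
    rw [← mul_assoc, polarWeight_eq hα, ← mul_pow, hu, norm_logPolar, ← Real.exp_mul]
    have : Real.exp (y.1 * ((d : ℝ) - 2 - 2 * a)) = Real.exp (α * y.1) ^ 2 := by
      rw [← Real.exp_nat_mul, hα]; push_cast; ring_nf
    rw [this, ← mul_pow, hu]
  rw [e1, integralLE_logPolar hd]
  simp only [e3]
  refine imp_congr_right fun h1 => ?_
  rw [e2, h1, hα]
  ring_nf

theorem weightedLogHardy_iff (hd : 1 ≤ d) (ha : a < ((d : ℝ) - 2) / 2) (γ C : ℝ) :
    WeightedLogHardy d a γ C ↔ CylinderLogHardy d a γ C := by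
  obtain ⟨α, hα⟩ : ∃ α, α = ((d : ℝ) - 2 - 2 * a) / 2 := ⟨_, rfl⟩
  have hα0 : α ≠ 0 := by
    have : 0 < α := by rw [hα]; linarith
    exact this.ne'
  constructor
  · intro h w G hw
    obtain ⟨u, H, hD, hu, hH⟩ := hw.exists_isD12 hd hα hα0
    exact (logHardy_iff_of_correspondence hd hα hw hu hH γ C).1 (h u H hD)
  · intro h u H hD
    have hw := hD.isH1Cylinder hd hα
    exact (logHardy_iff_of_correspondence hd hα hw (fun _ => rfl)
      (fun y => (cylToSpace_spaceToCyl α (norm_sphere y.2) _ _).symm) γ C).2 (h _ _ hw)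

end correspondence

/-! ### Entropy bounds from higher integrability. -/

section logBounds
variable {X : Type*} [MeasurableSpace X] {μ : Measure X}

theorem IntegralLE.of_le {f g : X → ℝ} {B : ℝ} (hf : AEStronglyMeasurable f μ)
    (hg : Integrable g μ) (h : f ≤ᵐ[μ] g) (hB : ∫ x, g x ∂μ ≤ B) : IntegralLE μ f B := by
  refine ⟨Integrable.mono' hg.norm (hf.sup aestronglyMeasurable_const) ?_,
    fun hi => (integral_mono_ae hi hg h).trans hB⟩
  filter_upwards [h] with x hx
  rw [Real.norm_eq_abs, abs_of_nonneg (le_max_right _ _)]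
  exact max_le (hx.trans (le_abs_self _)) (norm_nonneg _)

theorem IntegralLE.mono {f : X → ℝ} {B B' : ℝ} (h : IntegralLE μ f B) (hB : B ≤ B') :
    IntegralLE μ f B' := ⟨h.1, fun hi => (h.2 hi).trans hB⟩

theorem aestronglyMeasurable_sq_mul_log_sq {w : X → ℝ} (hw : AEStronglyMeasurable w μ) :
    AEStronglyMeasurable (fun x => w x ^ 2 * Real.log (w x ^ 2)) μ := by
  have := hw.aemeasurable
  exact AEMeasurable.aestronglyMeasurable (by fun_prop)

/-- Jensen's inequality bounds the entropy by the logarithm of a higher norm. -/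
theorem integralLE_sq_mul_log_sq {w : X → ℝ} (hw : MemLp w 2 μ) (h1 : ∫ x, w x ^ 2 ∂μ = 1)
    {q M : ℝ} (hq : 0 < q) (hM : 0 < M)
    (h : ∫⁻ x, ‖w x ^ 2‖ₑ ^ (1 + q) ∂μ ≤ ENNReal.ofReal M) :
    IntegralLE μ (fun x => w x ^ 2 * Real.log (w x ^ 2)) (1 / q * Real.log M) := by
  have hm : AEStronglyMeasurable (fun x => (w x ^ 2) ^ (1 + q)) μ :=
    AEMeasurable.aestronglyMeasurable ((hw.1.aemeasurable.pow_const 2).pow_const (1 + q))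
  have hnn : ∀ x, 0 ≤ (w x ^ 2) ^ (1 + q) := fun x => by positivity
  have he : ∀ x, ENNReal.ofReal ((w x ^ 2) ^ (1 + q)) = ‖w x ^ 2‖ₑ ^ (1 + q) := fun x => by
    rw [Real.enorm_eq_ofReal (sq_nonneg _),
      ENNReal.ofReal_rpow_of_nonneg (sq_nonneg _) (by positivity)]
  have hi : Integrable (fun x => (w x ^ 2) ^ (1 + q)) μ := by
    refine ⟨hm, ?_⟩
    rw [hasFiniteIntegral_iff_ofReal (ae_of_all _ hnn)]
    simp only [he]
    exact h.trans_lt ENNReal.ofReal_lt_top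
  have hle : ∫ x, (w x ^ 2) ^ (1 + q) ∂μ ≤ M := by
    rw [integral_eq_lintegral_of_nonneg_ae (ae_of_all _ hnn) hm]
    simp only [he]
    exact ENNReal.toReal_le_of_le_ofReal hM.le h
  have hw2 := hw.integrable_sq
  have hi1 : Integrable (fun x => 1 / (q * M) * (w x ^ 2) ^ (1 + q)) μ := hi.const_mul _
  have hi2 : Integrable (fun x => (Real.log M - 1) / q * w x ^ 2) μ := hw2.const_mul _
  refine IntegralLE.of_le (aestronglyMeasurable_sq_mul_log_sq hw.1) (hi1.add hi2)
    (ae_of_all _ fun x => ?_) ?_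
  · change w x ^ 2 * Real.log (w x ^ 2) ≤
      1 / (q * M) * (w x ^ 2) ^ (1 + q) + (Real.log M - 1) / q * w x ^ 2
    rcases eq_or_ne (w x) 0 with h0 | h0
    · rw [h0]
      have : 0 ≤ 1 / (q * M) * ((0 : ℝ) ^ 2) ^ (1 + q) := by positivity
      simpa using this
    · have ht : 0 < w x ^ 2 := by positivity
      set t := w x ^ 2
      -- Jensen in pointwise form: log lies below its tangent at M, evaluated at t^q. After
      -- integration against w² the linear terms cancel and (log M)/q remains.
      have hlog := Real.log_le_sub_one_of_pos (div_pos (Real.rpow_pos_of_pos ht q) hM)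
      rw [Real.log_div (Real.rpow_pos_of_pos ht q).ne' hM.ne', Real.log_rpow ht] at hlog
      have h3 : Real.log t ≤ (t ^ q / M - 1 + Real.log M) / q := by
        rw [le_div_iff₀ hq]; linarith
      calc t * Real.log t ≤ t * ((t ^ q / M - 1 + Real.log M) / q) := by gcongr
        _ = _ := by
          rw [Real.rpow_add ht, Real.rpow_one]; field_simp; ring
  · rw [show (fun x => 1 / (q * M) * (w x ^ 2) ^ (1 + q)) +
      (fun x => (Real.log M - 1) / q * w x ^ 2) = fun x => 1 / (q * M) * (w x ^ 2) ^ (1 + q) +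
      (Real.log M - 1) / q * w x ^ 2 from rfl, integral_add hi1 hi2, integral_const_mul,
      integral_const_mul, h1]
    have : 1 / (q * M) * ∫ x, (w x ^ 2) ^ (1 + q) ∂μ ≤ 1 / (q * M) * M := by gcongr
    calc _ ≤ 1 / (q * M) * M + (Real.log M - 1) / q * 1 := by gcongr
      _ = _ := by field_simp; ring

theorem integralLE_sq_mul_log_sq_of_bounded {w : X → ℝ} (hw : MemLp w 2 μ)
    (h1 : ∫ x, w x ^ 2 ∂μ = 1) {M : ℝ} (h : ∀ᵐ x ∂μ, w x ^ 2 ≤ M) :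
    IntegralLE μ (fun x => w x ^ 2 * Real.log (w x ^ 2)) (Real.log M) := by
  refine IntegralLE.of_le (aestronglyMeasurable_sq_mul_log_sq hw.1)
    (hw.integrable_sq.mul_const (Real.log M)) ?_ ?_
  · filter_upwards [h] with x hx
    rcases eq_or_ne (w x) 0 with h0 | h0
    · simp [h0]
    · have ht : 0 < w x ^ 2 := by positivity
      gcongr
  · rw [integral_mul_const, h1, one_mul]

/-- The surplus (2γ - δ) log E is at least (2γ - δ) log E₀, a constant which K absorbs together with
L. This is where γ ≥ d/4 and the positivity of (d-2-2a)² enter. -/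
theorem exists_constant_of_log_bound {γ δ E₀ : ℝ} (hγ : 0 < γ) (hδ : δ ≤ 2 * γ) (hE₀ : 0 < E₀)
    (L : ℝ) : ∃ K : ℝ, 0 < K ∧ ∀ E, E₀ ≤ E → L + δ * Real.log E ≤ 2 * γ * Real.log (K * E) := by
  refine ⟨Real.exp ((L - (2 * γ - δ) * Real.log E₀) / (2 * γ)), Real.exp_pos _, fun E hE => ?_⟩
  rw [Real.log_mul (Real.exp_pos _).ne' (hE₀.trans_le hE).ne', Real.log_exp, mul_add,
    mul_div_cancel₀ _ (by positivity)]
  have := mul_le_mul_of_nonneg_left (Real.log_le_log hE₀ hE) (sub_nonneg.2 hδ)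
  linarith

end logBounds

/-! ### Existence of a constant for d ≥ 2. -/

section sobolev
variable {d : ℕ}

theorem tendsto_integral_norm_sq {X E : Type*} [MeasurableSpace X] {μ : Measure X}
    [NormedAddCommGroup E] {f : X → E} {u : ℕ → X → E} (hf : MemLp f 2 μ)
    (hu : ∀ n, MemLp (u n) 2 μ)
    (h : Tendsto (fun n => eLpNorm (fun x => u n x - f x) 2 μ) atTop (𝓝 0)) :
    Tendsto (fun n => ∫ x, ‖u n x‖ ^ 2 ∂μ) atTop (𝓝 (∫ x, ‖f x‖ ^ 2 ∂μ)) := by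
  have h' : Tendsto (fun n => eLpNorm (fun x => ‖u n x‖ - ‖f x‖) 2 μ) atTop (𝓝 0) :=
    tendsto_of_tendsto_of_tendsto_of_le_of_le tendsto_const_nhds h (fun _ => zero_le)
      fun n => eLpNorm_mono fun x => abs_norm_sub_norm_le _ _
  simpa only [sq] using
    tendsto_integral_mul_of_L2 hf.norm hf.norm (fun n => (hu n).norm) (fun n => (hu n).norm) h' h'

/-- Gagliardo–Nirenberg–Sobolev for v = |x|^{-β} Ψ² with β = d-1. As βp = d, the powers of e^s
cancel the Jacobian e^{ds} in |v|^p and in |∇v| alike. On the cylinder |∇v| becomes at most (d-1)Ψ²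
+ 4|Ψ||∇Ψ|, and Young's inequality with the free parameter l separates the product. -/
theorem lintegral_sq_rpow_le_of_compactly_supported (hd : 2 ≤ d) {p : ℝ}
    (hp : Real.HolderConjugate d p) {Ψ : ℝ × RSpace d → ℝ} (hΨ : ContDiff ℝ ∞ Ψ)
    (hR : ∃ R, ∀ s x, R ≤ |s| → Ψ (s, x) = 0)
    (h1 : MemLp (cylinderRestrict Ψ) 2 (cylinderMeasure d))
    (h2 : MemLp (cylinderGrad Ψ) 2 (cylinderMeasure d)) {l : ℝ} (hl : 0 < l) :
    ∫⁻ y, ‖cylinderRestrict Ψ y ^ 2‖ₑ ^ p ∂(cylinderMeasure d) ≤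
      lintegralPowLePowLIntegralFDerivConst (volume : Measure (RSpace d)) p *
      ENNReal.ofReal ((d - 1 + 2 * l) * ∫ y, ‖cylinderRestrict Ψ y‖ ^ 2 ∂(cylinderMeasure d) +
        2 / l * ∫ y, ‖cylinderGrad Ψ y‖ ^ 2 ∂(cylinderMeasure d)) ^ p := by
  have hd2 : (2 : ℝ) ≤ d := by exact_mod_cast hd
  obtain ⟨β, hβ⟩ : ∃ β : ℝ, β = d - 1 := ⟨_, rfl⟩
  have hβ0 : β ≠ 0 := by rw [hβ]; linarith
  have hβp : β * p = d := by
    rw [hβ]; exact hp.sub_one_mul_conj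
  obtain ⟨R, hR⟩ := hR
  have hdiff : Differentiable ℝ Ψ := hΨ.differentiable (by simp)
  have hΨ2 : ContDiff ℝ ∞ fun q => Ψ q * Ψ q := hΨ.mul hΨ
  obtain ⟨hv, hvs, -⟩ := isHardyTest_cylinderPullback (d := d) hβ0 hΨ2
    (R := R) fun s x hs => by simp [hR s x hs]
  set v := cylinderPullback β fun q => Ψ q * Ψ q with hvdef
  have hv1 : ContDiff ℝ 1 v := hv.of_le (by exact_mod_cast le_top)
  have gns := lintegral_pow_le_pow_lintegral_fderiv (volume : Measure (RSpace d)) hv1 hvs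
    (p := p) (by rwa [finrank_euclideanSpace_fin])
  have hvm := hv.continuous.measurable
  have hvf := (hv.continuous_fderiv (by simp)).measurable
  rw [lintegral_logPolar (by omega) _ (by fun_prop),
    lintegral_logPolar (by omega) _ hvf.enorm] at gns
  have hl1 : ∀ y : Cylinder d, ENNReal.ofReal (Real.exp (d * y.1)) * ‖v (logPolar d y)‖ₑ ^ p =
      ‖cylinderRestrict Ψ y ^ 2‖ₑ ^ p := fun y => by
    rw [hvdef, cylinderPullback_logPolar, enorm_mul, ENNReal.mul_rpow_of_nonneg _ _ hp.symm.nonneg,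
      Real.enorm_eq_ofReal (Real.exp_pos _).le,
      ENNReal.ofReal_rpow_of_nonneg (Real.exp_pos _).le hp.symm.nonneg, ← mul_assoc,
      ← ENNReal.ofReal_mul (Real.exp_pos _).le, ← Real.exp_mul, ← Real.exp_add, ← hβp]
    ring_nf
    simp [cylinderRestrict, sq]
  have hl2 : ∀ y : Cylinder d, ENNReal.ofReal (Real.exp (d * y.1)) *
      ‖fderiv ℝ v (logPolar d y)‖ₑ ≤
      ENNReal.ofReal ((d - 1 + 2 * l) * ‖cylinderRestrict Ψ y‖ ^ 2 +
        2 / l * ‖cylinderGrad Ψ y‖ ^ 2) := fun y => by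
    have e : ‖fderiv ℝ v (logPolar d y)‖ₑ = ENNReal.ofReal ‖gradient v (logPolar d y)‖ := by
      rw [norm_gradient, ofReal_norm]
    rw [e, ← ENNReal.ofReal_mul (Real.exp_pos _).le,
      gradient_cylinderPullback β (hΨ2.differentiable (by simp)), norm_smul, Real.norm_eq_abs,
      Real.abs_exp, ← mul_assoc, ← Real.exp_add,
      cylinderGrad_mul (hdiff _) (hdiff _), ← two_smul ℝ, smul_smul]
    refine ENNReal.ofReal_le_ofReal ?_
    have e0 : d * y.1 + -((β + 1) * y.1) = 0 := by rw [hβ]; ring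
    rw [e0, Real.exp_zero, one_mul]
    refine (norm_cylToSpace_le β (norm_sphere y.2) _ _).trans ?_
    have e1 : cylinderRestrict (fun q => Ψ q * Ψ q) y = cylinderRestrict Ψ y * cylinderRestrict Ψ y :=
      rfl
    rw [norm_smul, e1, norm_mul, norm_mul, Real.norm_ofNat, hβ, abs_of_nonneg (by linarith)]
    set A := ‖cylinderRestrict Ψ y‖
    set B := ‖cylinderGrad Ψ y‖
    have : 4 * (A * B) ≤ 2 * l * A ^ 2 + 2 / l * B ^ 2 := by
      have h0 : 0 ≤ 2 / l * (l * A - B) ^ 2 := by positivity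
      have h3 : 2 / l * (l * A - B) ^ 2 = 2 * l * A ^ 2 + 2 / l * B ^ 2 - 4 * (A * B) := by
        field_simp; ring
      linarith
    nlinarith
  have i1 : Integrable (fun y => (d - 1 + 2 * l) * ‖cylinderRestrict Ψ y‖ ^ 2)
    (cylinderMeasure d) := h1.norm.integrable_sq.const_mul _
  have i2 : Integrable (fun y => 2 / l * ‖cylinderGrad Ψ y‖ ^ 2)
    (cylinderMeasure d) := h2.norm.integrable_sq.const_mul _
  have hint : ∫⁻ y, ENNReal.ofReal ((d - 1 + 2 * l) * ‖cylinderRestrict Ψ y‖ ^ 2 +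
        2 / l * ‖cylinderGrad Ψ y‖ ^ 2) ∂(cylinderMeasure d) =
      ENNReal.ofReal ((d - 1 + 2 * l) * ∫ y, ‖cylinderRestrict Ψ y‖ ^ 2 ∂(cylinderMeasure d) +
        2 / l * ∫ y, ‖cylinderGrad Ψ y‖ ^ 2 ∂(cylinderMeasure d)) := by
    rw [← integral_const_mul, ← integral_const_mul, ← integral_add i1 i2]
    refine (ofReal_integral_eq_lintegral_ofReal (i1.add i2) (ae_of_all _ fun y => ?_)).symm
    have : (0 : ℝ) ≤ d - 1 + 2 * l := by linarith
    simp only [Pi.zero_apply, Pi.add_apply]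
    positivity
  simp only [hl1] at gns
  refine gns.trans ?_
  rw [← hint]
  have := hp.symm.nonneg
  gcongr
  exact hl2 _

/-- Fatou's lemma along an almost everywhere convergent subsequence. -/
theorem lintegral_sq_rpow_le_of_tendsto {X : Type*} [MeasurableSpace X] {μ : Measure X} {w : X → ℝ}
    {u : ℕ → X → ℝ} {p : ℝ} {b : ℕ → ℝ≥0∞} {B : ℝ≥0∞} (hw : AEStronglyMeasurable w μ)
    (hu : ∀ n, AEStronglyMeasurable (u n) μ)
    (t : Tendsto (fun n => eLpNorm (fun x => u n x - w x) 2 μ) atTop (𝓝 0))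
    (hb : ∀ n, ∫⁻ x, ‖u n x ^ 2‖ₑ ^ p ∂μ ≤ b n) (hB : Tendsto b atTop (𝓝 B)) :
    ∫⁻ x, ‖w x ^ 2‖ₑ ^ p ∂μ ≤ B := by
  obtain ⟨ns, hns, hae⟩ :=
    (tendstoInMeasure_of_tendsto_eLpNorm (by simp) hu hw t).exists_seq_tendsto_ae
  calc ∫⁻ x, ‖w x ^ 2‖ₑ ^ p ∂μ
      = ∫⁻ x, liminf (fun k => ‖u (ns k) x ^ 2‖ₑ ^ p) atTop ∂μ := by
        refine lintegral_congr_ae ?_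
        filter_upwards [hae] with y hy
        have h2 : Tendsto (fun k => ‖u (ns k) y ^ 2‖ₑ) atTop (𝓝 ‖w y ^ 2‖ₑ) := (hy.pow 2).enorm
        exact (h2.ennrpow_const p).liminf_eq.symm
    _ ≤ liminf (fun k => ∫⁻ x, ‖u (ns k) x ^ 2‖ₑ ^ p ∂μ) atTop :=
        lintegral_liminf_le' fun k =>
          ((hu (ns k)).aemeasurable.pow_const 2).enorm.pow_const p
    _ ≤ liminf (fun k => b (ns k)) atTop := liminf_le_liminf (Eventually.of_forall fun k => hb _)
    _ = B := (hB.comp hns.tendsto_atTop).liminf_eq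

theorem IsH1Cylinder.lintegral_sq_rpow_le (hd : 2 ≤ d) {p : ℝ} (hp : Real.HolderConjugate d p)
    {w : Cylinder d → ℝ} {G : Cylinder d → WithLp 2 (ℝ × RSpace d)} (h : IsH1Cylinder d w G)
    {l : ℝ} (hl : 0 < l) :
    ∫⁻ y, ‖w y ^ 2‖ₑ ^ p ∂(cylinderMeasure d) ≤
      lintegralPowLePowLIntegralFDerivConst (volume : Measure (RSpace d)) p *
      ENNReal.ofReal ((d - 1 + 2 * l) * ∫ y, ‖w y‖ ^ 2 ∂(cylinderMeasure d) +
        2 / l * ∫ y, ‖G y‖ ^ 2 ∂(cylinderMeasure d)) ^ p := by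
  obtain ⟨Ψ, hΨ, t1, t2⟩ := h.exists_compactly_supported
  have c1 := tendsto_integral_norm_sq h.1 (fun n => (hΨ n).2.2.1) t1
  have c2 := tendsto_integral_norm_sq h.2.1 (fun n => (hΨ n).2.2.2) t2
  have c3 := (ENNReal.tendsto_ofReal ((c1.const_mul (d - 1 + 2 * l)).add
    (c2.const_mul (2 / l)))).ennrpow_const p
  exact lintegral_sq_rpow_le_of_tendsto h.1.1 (fun n => (hΨ n).2.2.1.1) t1
    (fun n => lintegral_sq_rpow_le_of_compactly_supported hd hp (hΨ n).1 (hΨ n).2.1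
      (hΨ n).2.2.1 (hΨ n).2.2.2 hl)
    (ENNReal.Tendsto.const_mul c3 (Or.inr ENNReal.coe_ne_top))

theorem exists_cylinderLogHardy_of_two_le (hd : 2 ≤ d) {a γ : ℝ} (ha : a < ((d : ℝ) - 2) / 2)
    (hγ : (d : ℝ) / 4 ≤ γ) : ∃ K : ℝ, 0 < K ∧ CylinderLogHardy d a γ K := by
  have hd2 : (2 : ℝ) ≤ d := by exact_mod_cast hd
  have hE0 : 0 < ((d : ℝ) - 2 - 2 * a) ^ 2 / 4 := by
    have : 0 < (d : ℝ) - 2 - 2 * a := by linarith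
    positivity
  set E₀ := ((d : ℝ) - 2 - 2 * a) ^ 2 / 4
  obtain ⟨q, hq⟩ : ∃ q : ℝ, q = 1 / (d - 1) := ⟨_, rfl⟩
  have hd1 : (0 : ℝ) < d - 1 := by linarith
  have hq0 : 0 < q := by rw [hq]; positivity
  have hp : Real.HolderConjugate d (1 + q) := by
    rw [Real.holderConjugate_iff_eq_conjExponent (by linarith), hq]
    field_simp; ring
  -- The 1 is added only to make c positive.
  set c := (lintegralPowLePowLIntegralFDerivConst (volume : Measure (RSpace d)) (1 + q) : ℝ) + 1
  have hc : 0 < c := by positivity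
  set κ := (d - 1) / √E₀ + 4
  have hs0 : 0 < √E₀ := Real.sqrt_pos.2 hE0
  have hκ : 0 < κ := by positivity
  -- With M = c(κ√E)^{1+q} and (d-1)(1+q) = d, the entropy bound (1/q) log M equals (d-1) log c + d
  -- log κ + (d/2) log E.
  obtain ⟨K, hK, hKE⟩ := exists_constant_of_log_bound (γ := γ) (δ := d / 2) (by linarith)
    (by linarith) hE0 ((d - 1) * Real.log c + d * Real.log κ)
  refine ⟨K, hK, fun w G hw h1 => ?_⟩
  have he : 0 ≤ ∫ y, ‖G y‖ ^ 2 ∂(cylinderMeasure d) := integral_nonneg fun y => sq_nonneg _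
  have hE : E₀ ≤ (∫ y, ‖G y‖ ^ 2 ∂(cylinderMeasure d)) + E₀ := by linarith
  refine IntegralLE.mono ?_ (hKE _ hE)
  set e := ∫ y, ‖G y‖ ^ 2 ∂(cylinderMeasure d)
  set E := e + E₀
  have hEpos : 0 < E := hE0.trans_le hE
  have hs : 0 < √E := Real.sqrt_pos.2 hEpos
  have hM : 0 < c * (κ * √E) ^ (1 + q) := by positivity
  -- The choice l = √E makes both Young terms at most 2√E; the remaining d-1 is absorbed into κ√E
  -- because E ≥ E₀.
  have hb := hw.lintegral_sq_rpow_le hd hp hs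
  have h1' : ∫ y, ‖w y‖ ^ 2 ∂(cylinderMeasure d) = 1 := by
    simpa only [Real.norm_eq_abs, sq_abs] using h1
  rw [h1'] at hb
  have hle : (d - 1 + 2 * √E) * 1 + 2 / √E * e ≤ κ * √E := by
    have i1 : 2 / √E * e ≤ 2 * √E := by
      rw [div_mul_eq_mul_div, div_le_iff₀ hs, mul_assoc, Real.mul_self_sqrt hEpos.le]
      have : e ≤ E := by simp only [E]; linarith
      linarith
    have i2 : (d : ℝ) - 1 ≤ (d - 1) / √E₀ * √E := by
      rw [div_mul_eq_mul_div, le_div_iff₀ hs0]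
      gcongr
    have : κ * √E = (d - 1) / √E₀ * √E + 4 * √E := by simp only [κ]; ring
    linarith
  have hb2 : ∫⁻ y, ‖w y ^ 2‖ₑ ^ (1 + q) ∂(cylinderMeasure d) ≤
      ENNReal.ofReal (c * (κ * √E) ^ (1 + q)) := by
    refine hb.trans ?_
    rw [ENNReal.ofReal_mul hc.le, ← ENNReal.ofReal_rpow_of_nonneg (by positivity) (by positivity)]
    gcongr
    rw [← ENNReal.ofReal_coe_nnreal]
    exact ENNReal.ofReal_le_ofReal (by simp only [c]; linarith)
  refine (integralLE_sq_mul_log_sq hw.1 h1 hq0 hM hb2).mono (le_of_eq ?_)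
  rw [Real.log_mul hc.ne' (by positivity), Real.log_rpow (by positivity),
    Real.log_mul hκ.ne' hs.ne', Real.log_sqrt hEpos.le, hq]
  field_simp
  ring

end sobolev

/-! ### Dimension one: the cylinder as two lines. -/

section dimensionOne

/-- The point `1` of the unit sphere of `ℝ^1`. -/
def spherePos : Metric.sphere (0 : RSpace 1) 1 :=
  ⟨EuclideanSpace.single 0 1, by simp⟩

/-- The point `-1` of the unit sphere of `ℝ^1`. -/
def sphereNeg : Metric.sphere (0 : RSpace 1) 1 :=
  ⟨EuclideanSpace.single 0 (-1), by simp⟩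

theorem spherePos_apply : (spherePos : RSpace 1) 0 = 1 := by simp [spherePos]

theorem sphereNeg_apply : (sphereNeg : RSpace 1) 0 = -1 := by simp [sphereNeg]

theorem ext_rspace_one {x y : RSpace 1} (h : x 0 = y 0) : x = y := by
  ext i; rw [Subsingleton.elim i 0, h]

theorem sphere_sq_eq_one {θ : RSpace 1} (hθ : ‖θ‖ = 1) : θ 0 * θ 0 = 1 := by
  have : ‖θ‖ ^ 2 = 1 := by rw [hθ]; norm_num
  rw [EuclideanSpace.real_norm_sq_eq] at this
  simpa [sq] using this

theorem eq_spherePos_or_sphereNeg (θ : Metric.sphere (0 : RSpace 1) 1) :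
    θ = spherePos ∨ θ = sphereNeg := by
  rcases mul_self_eq_one_iff.1 (sphere_sq_eq_one (norm_sphere θ)) with h | h
  · exact Or.inl (Subtype.ext (ext_rspace_one (by rw [h, spherePos_apply])))
  · exact Or.inr (Subtype.ext (ext_rspace_one (by rw [h, sphereNeg_apply])))

theorem proj_eq_zero_of_dim_one {θ : RSpace 1} (hθ : ‖θ‖ = 1) (g : RSpace 1) :
    g - (inner ℝ g θ) • θ = 0 := by
  refine ext_rspace_one ?_
  have := sphere_sq_eq_one hθ
  simp [PiLp.inner_apply]
  linear_combination (-(g 0)) * this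

theorem measurePreserving_coord_zero :
    MeasurePreserving (fun x : RSpace 1 => x 0) volume volume :=
  (volume_preserving_funUnique (Fin 1) ℝ).comp (PiLp.volume_preserving_ofLp (Fin 1))

open scoped Pointwise in
-- The surface measure is the dimension times the volume of the cone over the set; here the
-- dimension is 1 and the cone over a point is an interval of length 1.
theorem toSphere_singleton {θ : Metric.sphere (0 : RSpace 1) 1} {l r : ℝ} (hlr : r - l = 1)
    (h : ∀ t : ℝ, t ∈ Set.Ioo l r ↔ t * (θ : RSpace 1) 0 ∈ Set.Ioo (0 : ℝ) 1) :
    (volume : Measure (RSpace 1)).toSphere {θ} = 1 := by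
  rw [Measure.toSphere_apply' _ (measurableSet_singleton _)]
  have hθ := sphere_sq_eq_one (norm_sphere θ)
  have : (Set.Ioo (0 : ℝ) 1 • (Subtype.val '' ({θ} : Set (Metric.sphere (0 : RSpace 1) 1))) :
      Set (RSpace 1)) = (fun x : RSpace 1 => x 0) ⁻¹' Set.Ioo l r := by
    ext x
    simp only [Set.image_singleton, Set.mem_smul, Set.mem_singleton_iff, exists_eq_left,
      Set.mem_preimage, h]
    constructor
    · rintro ⟨t, ht, rfl⟩
      simpa [mul_assoc, hθ] using ht
    · intro hx
      refine ⟨_, hx, ext_rspace_one ?_⟩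
      simp [mul_assoc, hθ]
  rw [this, measurePreserving_coord_zero.measure_preimage measurableSet_Ioo.nullMeasurableSet]
  simp [hlr]

theorem toSphere_one : (volume : Measure (RSpace 1)).toSphere =
    Measure.dirac spherePos + Measure.dirac sphereNeg := by
  have hne : spherePos ≠ sphereNeg := fun h => by
    have := congrArg (fun θ : Metric.sphere (0 : RSpace 1) 1 => (θ : RSpace 1) 0) h
    simp only [spherePos_apply, sphereNeg_apply] at this
    norm_num at this
  have : Countable (Metric.sphere (0 : RSpace 1) 1) := by
    refine Set.countable_univ_iff.1 (((Set.toFinite {spherePos, sphereNeg}).countable).mono ?_)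
    intro θ _
    exact eq_spherePos_or_sphereNeg θ
  refine Measure.ext_of_singleton fun θ => ?_
  rcases eq_spherePos_or_sphereNeg θ with rfl | rfl
  · rw [toSphere_singleton (l := 0) (r := 1) (by norm_num) (by simp [spherePos_apply])]
    simp [hne.symm]
  · rw [toSphere_singleton (l := -1) (r := 0) (by norm_num) (by
      intro t; simp only [sphereNeg_apply, Set.mem_Ioo]; constructor <;> rintro ⟨_, _⟩ <;>
        constructor <;> linarith)]
    simp [hne]

/-- The copy of the line over a point of the sphere. -/
def slice (θ : Metric.sphere (0 : RSpace 1) 1) (s : ℝ) : Cylinder 1 := (s, θ)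

theorem measurableEmbedding_slice (θ : Metric.sphere (0 : RSpace 1) 1) :
    MeasurableEmbedding (slice θ) := measurableEmbedding_prod_mk_right θ

theorem cylinderMeasure_one : cylinderMeasure 1 =
    Measure.map (slice spherePos) volume + Measure.map (slice sphereNeg) volume := by
  rw [cylinderMeasure, toSphere_one, Measure.prod_add, Measure.prod_dirac, Measure.prod_dirac]
  rfl

theorem map_slice_le (θ : Metric.sphere (0 : RSpace 1) 1) :
    Measure.map (slice θ) volume ≤ cylinderMeasure 1 := by
  rw [cylinderMeasure_one]
  rcases eq_spherePos_or_sphereNeg θ with rfl | rfl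
  · exact Measure.le_add_right le_rfl
  · exact Measure.le_add_left le_rfl

section slices
variable {E : Type*} [NormedAddCommGroup E]

theorem MemLp.slice {f : Cylinder 1 → E} (hf : MemLp f 2 (cylinderMeasure 1))
    (θ : Metric.sphere (0 : RSpace 1) 1) : MemLp (fun s => f (s, θ)) 2 volume :=
  (measurableEmbedding_slice θ).memLp_map_measure_iff.1 (hf.mono_measure (map_slice_le θ))

theorem eLpNorm_slice_le (f : Cylinder 1 → E) (θ : Metric.sphere (0 : RSpace 1) 1) :
    eLpNorm (fun s => f (s, θ)) 2 volume ≤ eLpNorm f 2 (cylinderMeasure 1) := by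
  have h := (measurableEmbedding_slice θ).eLpNorm_map_measure (p := 2) (μ := volume) (g := f)
  exact h.symm.le.trans (eLpNorm_mono_measure f (map_slice_le θ))

theorem integrable_cylinder_one {f : Cylinder 1 → E} : Integrable f (cylinderMeasure 1) ↔
    Integrable (fun s => f (s, spherePos)) ∧ Integrable (fun s => f (s, sphereNeg)) := by
  rw [cylinderMeasure_one, integrable_add_measure,
    (measurableEmbedding_slice _).integrable_map_iff,
    (measurableEmbedding_slice _).integrable_map_iff]
  rfl

theorem integral_cylinder_one {f : Cylinder 1 → ℝ} (hf : Integrable f (cylinderMeasure 1)) :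
    ∫ y, f y ∂(cylinderMeasure 1) = (∫ s, f (s, spherePos)) + ∫ s, f (s, sphereNeg) := by
  have h := hf
  rw [cylinderMeasure_one, integrable_add_measure] at h
  rw [cylinderMeasure_one, integral_add_measure h.1 h.2,
    (measurableEmbedding_slice _).integral_map, (measurableEmbedding_slice _).integral_map]
  rfl

theorem eLpNorm_cylinder_one {f : Cylinder 1 → E} (hf : ∀ s, f (s, sphereNeg) = 0) :
    eLpNorm f 2 (cylinderMeasure 1) = eLpNorm (fun s => f (s, spherePos)) 2 volume := by
  rw [eLpNorm_eq_lintegral_rpow_enorm_toReal (by simp) (by simp),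
    eLpNorm_eq_lintegral_rpow_enorm_toReal (by simp) (by simp), cylinderMeasure_one,
    lintegral_add_measure, (measurableEmbedding_slice _).lintegral_map,
    (measurableEmbedding_slice _).lintegral_map]
  simp [slice, hf]

theorem memLp_cylinder_one {f : Cylinder 1 → E} (hf : ∀ s, f (s, sphereNeg) = 0)
    (h : MemLp (fun s => f (s, spherePos)) 2 volume) : MemLp f 2 (cylinderMeasure 1) := by
  refine ⟨?_, by rw [eLpNorm_cylinder_one hf]; exact h.2⟩
  rw [cylinderMeasure_one, aestronglyMeasurable_add_measure_iff,
    (measurableEmbedding_slice _).aestronglyMeasurable_map_iff,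
    (measurableEmbedding_slice _).aestronglyMeasurable_map_iff]
  refine ⟨h.1, ?_⟩
  rw [show f ∘ slice sphereNeg = fun _ => 0 from funext hf]
  exact aestronglyMeasurable_const

end slices

theorem IntegralLE.of_slices {f : Cylinder 1 → ℝ} {B B' : ℝ}
    (h : IntegralLE volume (fun s => f (s, spherePos)) B)
    (h' : IntegralLE volume (fun s => f (s, sphereNeg)) B') :
    IntegralLE (cylinderMeasure 1) f (B + B') := by
  refine ⟨integrable_cylinder_one.2 ⟨h.1, h'.1⟩, fun hi => ?_⟩
  rw [integral_cylinder_one hi]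
  have := integrable_cylinder_one.1 hi
  exact add_le_add (h.2 this.1) (h'.2 this.2)

theorem IntegralLE.spherePos_slice {f : Cylinder 1 → ℝ} {B : ℝ} (hf : ∀ s, f (s, sphereNeg) = 0)
    (h : IntegralLE (cylinderMeasure 1) f B) :
    IntegralLE volume (fun s => f (s, spherePos)) B := by
  refine ⟨(integrable_cylinder_one.1 h.1).1, fun hi => ?_⟩
  have hi' : Integrable f (cylinderMeasure 1) :=
    integrable_cylinder_one.2 ⟨hi, by simp only [hf]; exact integrable_zero _ _ _⟩
  have := h.2 hi'
  rw [integral_cylinder_one hi'] at this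
  simpa [hf] using this

theorem IsH1Cylinder.slice {w : Cylinder 1 → ℝ} {G : Cylinder 1 → WithLp 2 (ℝ × RSpace 1)}
    (h : IsH1Cylinder 1 w G) (θ : Metric.sphere (0 : RSpace 1) 1) :
    IsH1Line (fun s => w (s, θ)) (fun s => (G (s, θ)).fst) := by
  obtain ⟨hw, hG, φ, hφ, t1, t2⟩ := h
  refine ⟨MemLp.slice hw θ, MemLp.slice (memLp_fst hG) θ, fun n s => φ n (s, (θ : RSpace 1)),
    fun n => ⟨?_, MemLp.slice (hφ n).2.1 θ, MemLp.slice (memLp_fst (hφ n).2.2) θ⟩, ?_, ?_⟩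
  · exact (hφ n).1.comp (contDiff_id.prodMk contDiff_const)
  · exact tendsto_of_tendsto_of_tendsto_of_le_of_le tendsto_const_nhds t1 (fun _ => zero_le)
      fun n => eLpNorm_slice_le (fun y => cylinderRestrict (φ n) y - w y) θ
  · refine tendsto_of_tendsto_of_tendsto_of_le_of_le tendsto_const_nhds t2 (fun _ => zero_le)
      fun n => le_trans ?_ (eLpNorm_slice_le (fun y => cylinderGrad (φ n) y - G y) θ)
    refine eLpNorm_mono fun s => ?_
    exact WithLp.norm_fst_le _ (cylinderGrad (φ n) (s, θ) - G (s, θ))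

/-- The function on `ℝ^1` equal to `1` at `1` and to `0` at `-1`. -/
def posCoord (x : RSpace 1) : ℝ := (1 + x 0) / 2

theorem posCoord_spherePos : posCoord spherePos = 1 := by
  rw [posCoord, spherePos_apply]; norm_num

theorem posCoord_sphereNeg : posCoord sphereNeg = 0 := by
  rw [posCoord, sphereNeg_apply]; norm_num

theorem cylinderGrad_mul_posCoord (φ : ℝ → ℝ) (y : Cylinder 1) :
    cylinderGrad (fun p => φ p.1 * posCoord p.2) y =
      WithLp.toLp 2 (deriv φ y.1 * posCoord y.2, 0) := by
  rw [cylinderGrad]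
  simp only [proj_eq_zero_of_dim_one (norm_sphere y.2), deriv_mul_const_field]

/-- Extension by zero to the sheet over -1. Multiplying by the affine function `posCoord` keeps the
approximants smooth on ℝ × ℝ^1, and the tangent space of S^0 being trivial, no angular derivative
appears. -/
theorem IsH1Line.isH1Cylinder {w g : ℝ → ℝ} (h : IsH1Line w g) :
    IsH1Cylinder 1 (fun y => w y.1 * posCoord y.2)
      (fun y => WithLp.toLp 2 (g y.1 * posCoord y.2, 0)) := by
  obtain ⟨hw, hg, φ, hφ, t1, t2⟩ := h
  have m1 : ∀ {u : ℝ → ℝ}, MemLp u 2 volume →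
      MemLp (fun y : Cylinder 1 => u y.1 * posCoord y.2) 2 (cylinderMeasure 1) := fun hu =>
    memLp_cylinder_one (by simp [posCoord_sphereNeg]) (by simpa [posCoord_spherePos] using hu)
  have m2 : ∀ {u : ℝ → ℝ}, MemLp u 2 volume →
      MemLp (fun y : Cylinder 1 => WithLp.toLp 2 (u y.1 * posCoord y.2, (0 : RSpace 1))) 2
        (cylinderMeasure 1) := fun {u} hu => by
    refine memLp_cylinder_one (by simp [posCoord_sphereNeg]) ?_
    simp only [posCoord_spherePos, mul_one]
    have hc : Continuous fun t : ℝ => WithLp.toLp 2 (t, (0 : RSpace 1)) :=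
      (WithLp.prod_continuous_toLp 2 ℝ (RSpace 1)).comp (by fun_prop)
    refine hu.mono (hc.comp_aestronglyMeasurable hu.1) (ae_of_all _ fun s => ?_)
    rw [WithLp.norm_toLp_fst]
  refine ⟨m1 hw, m2 hg, fun n p => φ n p.1 * posCoord p.2, fun n => ⟨?_, m1 (hφ n).2.1, ?_⟩, ?_, ?_⟩
  · have h1 := (hφ n).1
    unfold posCoord
    fun_prop
  · rw [funext (cylinderGrad_mul_posCoord (φ n))]
    exact m2 (hφ n).2.2
  · refine t1.congr fun n => ?_
    rw [eLpNorm_cylinder_one (by simp [cylinderRestrict, posCoord_sphereNeg])]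
    simp [cylinderRestrict, posCoord_spherePos]
  · refine t2.congr fun n => ?_
    simp only [cylinderGrad_mul_posCoord (φ n)]
    rw [eLpNorm_cylinder_one (by simp [posCoord_sphereNeg])]
    simp only [posCoord_spherePos, mul_one, ← WithLp.toLp_sub, Prod.mk_sub_mk, sub_zero]
    refine (eLpNorm_congr_norm_ae (ae_of_all _ fun s => ?_))
    rw [WithLp.norm_toLp_fst]

theorem CylinderLogHardy.line {a γ K : ℝ} (h : CylinderLogHardy 1 a γ K) : LineLogHardy a γ K := by
  intro w g hw h1
  have hc := hw.isH1Cylinder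
  have e1 : ∫ y, (w y.1 * posCoord y.2) ^ 2 ∂(cylinderMeasure 1) = ∫ s, w s ^ 2 := by
    rw [integral_cylinder_one hc.1.integrable_sq]
    simp [posCoord_spherePos, posCoord_sphereNeg]
  have e2 : ∫ y, ‖WithLp.toLp 2 (g y.1 * posCoord y.2, (0 : RSpace 1))‖ ^ 2 ∂(cylinderMeasure 1) =
      ∫ s, g s ^ 2 := by
    rw [integral_cylinder_one hc.2.1.norm.integrable_sq]
    simp [posCoord_spherePos, posCoord_sphereNeg]
  have := h _ _ hc (by rw [e1, h1])
  rw [e2] at this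
  simpa [posCoord_spherePos] using this.spherePos_slice (by simp [posCoord_sphereNeg])

theorem IsH1Line.const_mul {w g : ℝ → ℝ} (h : IsH1Line w g) (c : ℝ) :
    IsH1Line (fun s => c * w s) (fun s => c * g s) := by
  obtain ⟨hw, hg, φ, hφ, t1, t2⟩ := h
  have hd : ∀ n, deriv (fun s => c * φ n s) = fun s => c * deriv (φ n) s := fun n =>
    funext fun s => deriv_const_mul_field c
  have ht : ∀ {u : ℕ → ℝ → ℝ}, Tendsto (fun n => eLpNorm (u n) 2 volume) atTop (𝓝 0) →
      Tendsto (fun n => eLpNorm (fun s => c * u n s) 2 volume) atTop (𝓝 0) := fun {u} hu => by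
    have := ENNReal.Tendsto.const_mul (a := ‖c‖ₑ) hu (Or.inr enorm_ne_top)
    rw [mul_zero] at this
    exact this.congr fun n => (eLpNorm_const_smul c (u n) 2 volume).symm
  refine ⟨hw.const_mul c, hg.const_mul c, fun n s => c * φ n s, fun n => ⟨?_, ?_, ?_⟩, ?_, ?_⟩
  · exact contDiff_const.mul (hφ n).1
  · exact (hφ n).2.1.const_mul c
  · rw [hd]; exact (hφ n).2.2.const_mul c
  · simp only [← mul_sub]; exact ht t1
  · simp only [hd, ← mul_sub]; exact ht t2

/-- The inequality on the line for functions that need not be normalized. -/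
theorem LineLogHardy.homogeneous {a γ K : ℝ} (h : LineLogHardy a γ K) {w g : ℝ → ℝ}
    (hw : IsH1Line w g) {m : ℝ} (hm : ∫ s, w s ^ 2 = m) :
    IntegralLE volume (fun s => w s ^ 2 * Real.log (w s ^ 2))
      (2 * γ * (m * Real.log (K * ((∫ s, g s ^ 2) / m + ((1 : ℝ) - 2 - 2 * a) ^ 2 / 4))) +
        m * Real.log m) := by
  have hi := hw.1.integrable_sq
  rcases (hm ▸ integral_nonneg fun s => sq_nonneg (w s) : 0 ≤ m).eq_or_lt with h0 | h0
  -- When m = 0, w vanishes almost everywhere, and the bound is 0 whatever value the quotient by m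
  -- takes.
  · subst h0
    rw [integral_eq_zero_iff_of_nonneg (fun s => sq_nonneg _) hi] at hm
    refine IntegralLE.of_le (g := fun _ => 0) (aestronglyMeasurable_sq_mul_log_sq hw.1.1)
      (integrable_zero _ _ _) ?_ (by simp)
    filter_upwards [hm] with s hs
    rw [hs]; simp
  · have hc2 : (√m)⁻¹ ^ 2 = m⁻¹ := by rw [inv_pow, Real.sq_sqrt h0.le]
    have := h _ _ (hw.const_mul (√m)⁻¹) (by
      simp only [mul_pow, hc2, integral_const_mul, hm, inv_mul_cancel₀ h0.ne'])
    simp only [mul_pow, hc2, integral_const_mul] at this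
    rw [← div_eq_inv_mul] at this
    set L := Real.log (K * ((∫ s, g s ^ 2) / m + ((1 : ℝ) - 2 - 2 * a) ^ 2 / 4))
    obtain ⟨hp, hb⟩ := this
    have hid : ∀ s, w s ^ 2 * Real.log (w s ^ 2) =
        m * (m⁻¹ * w s ^ 2 * Real.log (m⁻¹ * w s ^ 2)) + Real.log m * w s ^ 2 := fun s => by
      rcases eq_or_ne (w s) 0 with hs | hs
      · simp [hs]
      · rw [Real.log_mul (inv_ne_zero h0.ne') (by positivity), Real.log_inv]
        field_simp
        ring
    have hlm : Integrable (fun s => Real.log m * w s ^ 2) := hi.const_mul _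
    constructor
    · have hmeas := aestronglyMeasurable_sq_mul_log_sq hw.1.1
      refine Integrable.mono' ((hp.const_mul m).add hlm.norm) (hmeas.sup aestronglyMeasurable_const)
        (ae_of_all _ fun s => ?_)
      rw [Real.norm_eq_abs, abs_of_nonneg (le_max_right _ _)]
      refine max_le ((hid s).le.trans (add_le_add ?_ (le_abs_self _))) ?_
      · exact mul_le_mul_of_nonneg_left (le_max_left _ _) h0.le
      · exact add_nonneg (mul_nonneg h0.le (le_max_right _ _)) (norm_nonneg _)
    · intro hint
      have hv : Integrable fun s => m⁻¹ * w s ^ 2 * Real.log (m⁻¹ * w s ^ 2) := by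
        refine ((hint.sub hlm).const_mul m⁻¹).congr (ae_of_all _ fun s => ?_)
        simp only [Pi.sub_apply, hid]
        field_simp
        ring
      simp only [hid]
      rw [integral_add (hv.const_mul m) hlm, integral_const_mul, integral_const_mul, hm]
      have := mul_le_mul_of_nonneg_left (hb hv) h0.le
      linarith

/-- The homogeneous line inequality is added over the two sheets, of masses m + m' = 1. Concavity of
log merges the two right-hand sides into the one for the total energy, and m log m + m' log m' ≤ 0
is discarded. -/
theorem LineLogHardy.cylinder {a γ K : ℝ} (ha : a < -1 / 2) (hγ : 0 < γ) (hK : 0 < K)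
    (h : LineLogHardy a γ K) : CylinderLogHardy 1 a γ K := by
  intro w G hw h1
  have hα : 0 < ((1 : ℝ) - 2 - 2 * a) ^ 2 / 4 := by
    have : 0 < (1 : ℝ) - 2 - 2 * a := by linarith
    positivity
  have hwi := hw.1.integrable_sq
  have hGi : Integrable (fun y => ‖G y‖ ^ 2) (cylinderMeasure 1) := hw.2.1.norm.integrable_sq
  have hgi : Integrable (fun y => (G y).fst ^ 2) (cylinderMeasure 1) :=
    (memLp_fst hw.2.1).integrable_sq
  have hG : (∫ s, (G (s, spherePos)).fst ^ 2) + ∫ s, (G (s, sphereNeg)).fst ^ 2 ≤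
      ∫ y, ‖G y‖ ^ 2 ∂(cylinderMeasure 1) := by
    rw [← integral_cylinder_one (f := fun y => (G y).fst ^ 2) hgi]
    refine integral_mono hgi hGi fun y => ?_
    rw [← sq_abs, ← Real.norm_eq_abs]
    have := WithLp.norm_fst_le _ (G y)
    gcongr
  rw [integral_cylinder_one hwi] at h1
  have hp := h.homogeneous (hw.slice spherePos) rfl
  have hn := h.homogeneous (hw.slice sphereNeg) rfl
  refine (IntegralLE.of_slices (f := fun y => w y ^ 2 * Real.log (w y ^ 2)) hp hn).mono ?_
  have m1 : 0 ≤ ∫ s, w (s, spherePos) ^ 2 := integral_nonneg fun s => sq_nonneg _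
  have m2 : 0 ≤ ∫ s, w (s, sphereNeg) ^ 2 := integral_nonneg fun s => sq_nonneg _
  have g1 : 0 ≤ ∫ s, (G (s, spherePos)).fst ^ 2 := integral_nonneg fun s => sq_nonneg _
  have g2 : 0 ≤ ∫ s, (G (s, sphereNeg)).fst ^ 2 := integral_nonneg fun s => sq_nonneg _
  push_cast
  set m := ∫ s, w (s, spherePos) ^ 2
  set m' := ∫ s, w (s, sphereNeg) ^ 2
  set e := ∫ s, (G (s, spherePos)).fst ^ 2
  set e' := ∫ s, (G (s, sphereNeg)).fst ^ 2
  set A := ((1 : ℝ) - 2 - 2 * a) ^ 2 / 4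
  set Q := ∫ y, ‖G y‖ ^ 2 ∂(cylinderMeasure 1)
  have hX : 0 < K * (Q + A) := by
    have : 0 < Q + A := by linarith
    positivity
  -- Tangent line of log at K(Q + A), in a form that also covers m = 0; summing over the sheets
  -- gives the concavity inequality.
  have key : ∀ m e : ℝ, 0 ≤ m → 0 ≤ e → m * Real.log (K * (e / m + A)) ≤
      m * Real.log (K * (Q + A)) + K * (e + m * A) / (K * (Q + A)) - m := by
    intro m e hm he
    have hx : 0 < K * (e / m + A) := by positivity
    have hlog := Real.log_le_sub_one_of_pos (div_pos hx hX)
    rw [Real.log_div hx.ne' hX.ne'] at hlog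
    have h3 := mul_le_mul_of_nonneg_left hlog hm
    have h4 : m * (K * (e / m + A) / (K * (Q + A))) ≤ K * (e + m * A) / (K * (Q + A)) := by
      have : m * (e / m) ≤ e := by
        rcases hm.eq_or_lt with h0 | h0
        · rw [← h0]; simpa using he
        · rw [mul_div_cancel₀ _ h0.ne']
      rw [← mul_div_assoc, mul_left_comm, mul_add]
      gcongr
    linarith
  have k1 := key m e m1 g1
  have k2 := key m' e' m2 g2
  have l1 : m * Real.log m ≤ 0 := Real.mul_log_nonpos m1 (by linarith)
  have l2 : m' * Real.log m' ≤ 0 := Real.mul_log_nonpos m2 (by linarith)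
  have k3 : K * (e + m * A) / (K * (Q + A)) + K * (e' + m' * A) / (K * (Q + A)) ≤ 1 := by
    rw [← add_div, div_le_one hX]
    have : K * (e + m * A) + K * (e' + m' * A) = K * (e + e' + (m + m') * A) := by ring
    rw [this, h1, one_mul]
    gcongr
  have hL : m * Real.log (K * (Q + A)) + m' * Real.log (K * (Q + A)) = Real.log (K * (Q + A)) := by
    rw [← add_mul, h1, one_mul]
  have : m * Real.log (K * (e / m + A)) + m' * Real.log (K * (e' / m' + A)) ≤
      Real.log (K * (Q + A)) := by linarith
  have := mul_le_mul_of_nonneg_left this (by positivity : 0 ≤ 2 * γ)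
  linarith

/-- φ² and its derivative are integrable, so φ² tends to 0 at -∞ and φ(s)² is the integral of 2φφ'
up to s; then 2φφ' ≤ lφ² + φ'²/l. -/
theorem sq_le_of_contDiff {φ : ℝ → ℝ} (hφ : ContDiff ℝ ∞ φ) (h1 : MemLp φ 2 volume)
    (h2 : MemLp (deriv φ) 2 volume) {l : ℝ} (hl : 0 < l) (s : ℝ) :
    φ s ^ 2 ≤ l * (∫ t, ‖φ t‖ ^ 2) + 1 / l * ∫ t, ‖deriv φ t‖ ^ 2 := by
  have hd : ∀ t, HasDerivAt (fun t => φ t ^ 2) (2 * (φ t * deriv φ t)) t := fun t => by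
    convert! (hφ.differentiable (by simp) t).hasDerivAt.pow 2 using 1
    ring
  have i0 : Integrable (fun t => 2 * (φ t * deriv φ t)) := (h1.integrable_mul h2).const_mul 2
  have i1 : Integrable (fun t => l * ‖φ t‖ ^ 2) := h1.norm.integrable_sq.const_mul l
  have i2 : Integrable (fun t => 1 / l * ‖deriv φ t‖ ^ 2) := h2.norm.integrable_sq.const_mul _
  have ht := tendsto_zero_of_hasDerivAt_of_integrableOn_Iic (a := s) (fun t _ => hd t)
    i0.integrableOn h1.integrable_sq.integrableOn
  have hF := integral_Iic_of_hasDerivAt_of_tendsto (a := s)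
    (hd s).continuousAt.continuousWithinAt (fun t _ => hd t) i0.integrableOn ht
  rw [sub_zero] at hF
  rw [← hF, ← integral_const_mul, ← integral_const_mul, ← integral_add i1 i2]
  calc ∫ t in Set.Iic s, 2 * (φ t * deriv φ t)
      ≤ ∫ t in Set.Iic s, (l * ‖φ t‖ ^ 2 + 1 / l * ‖deriv φ t‖ ^ 2) := by
        refine integral_mono i0.integrableOn (i1.add i2).integrableOn fun t => ?_
        simp only [Real.norm_eq_abs, sq_abs]
        have h0 : 0 ≤ 1 / l * (l * φ t - deriv φ t) ^ 2 := by positivity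
        have h3 : 1 / l * (l * φ t - deriv φ t) ^ 2 =
            l * φ t ^ 2 + 1 / l * deriv φ t ^ 2 - 2 * (φ t * deriv φ t) := by
          field_simp; ring
        linarith
    _ ≤ _ := setIntegral_le_integral (i1.add i2) (ae_of_all _ fun t => by
        simp only [Pi.zero_apply]; positivity)

theorem IsH1Line.sq_le {w g : ℝ → ℝ} (h : IsH1Line w g) {l : ℝ} (hl : 0 < l) :
    ∀ᵐ s, w s ^ 2 ≤ l * (∫ t, ‖w t‖ ^ 2) + 1 / l * ∫ t, ‖g t‖ ^ 2 := by
  obtain ⟨hw, hg, φ, hφ, t1, t2⟩ := h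
  have c1 := tendsto_integral_norm_sq hw (fun n => (hφ n).2.1) t1
  have c2 := tendsto_integral_norm_sq hg (fun n => (hφ n).2.2) t2
  have c3 := (c1.const_mul l).add (c2.const_mul (1 / l))
  obtain ⟨ns, hns, hae⟩ := (tendstoInMeasure_of_tendsto_eLpNorm (by simp)
    (fun n => (hφ n).2.1.1) hw.1 t1).exists_seq_tendsto_ae
  filter_upwards [hae] with s hs
  exact le_of_tendsto_of_tendsto' (hs.pow 2) (c3.comp hns.tendsto_atTop) fun k =>
    sq_le_of_contDiff (hφ (ns k)).1 (hφ (ns k)).2.1 (hφ (ns k)).2.2 hl s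

theorem exists_lineLogHardy {a γ : ℝ} (ha : a < -1 / 2) (hγ : 1 / 4 ≤ γ) :
    ∃ K : ℝ, 0 < K ∧ LineLogHardy a γ K := by
  have hE0 : 0 < ((1 : ℝ) - 2 - 2 * a) ^ 2 / 4 := by
    have : 0 < (1 : ℝ) - 2 - 2 * a := by linarith
    positivity
  set E₀ := ((1 : ℝ) - 2 - 2 * a) ^ 2 / 4
  -- With l = √E the pointwise bound is w² ≤ 2√E, so the entropy is at most log 2 + (1/2) log E.
  obtain ⟨K, hK, hKE⟩ := exists_constant_of_log_bound (γ := γ) (δ := 1 / 2) (by linarith)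
    (by linarith) hE0 (Real.log 2)
  refine ⟨K, hK, fun w g hw h1 => ?_⟩
  have he : 0 ≤ ∫ s, g s ^ 2 := integral_nonneg fun s => sq_nonneg _
  have hE : E₀ ≤ (∫ s, g s ^ 2) + E₀ := by linarith
  refine IntegralLE.mono ?_ (hKE _ hE)
  have hEpos : 0 < (∫ s, g s ^ 2) + E₀ := by linarith
  have hs : 0 < √((∫ s, g s ^ 2) + E₀) := Real.sqrt_pos.2 hEpos
  have hb := hw.sq_le hs
  simp only [Real.norm_eq_abs, sq_abs] at hb
  rw [h1] at hb
  set e := ∫ s, g s ^ 2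
  have hle : √(e + E₀) * 1 + 1 / √(e + E₀) * e ≤ 2 * √(e + E₀) := by
    have : 1 / √(e + E₀) * e ≤ √(e + E₀) := by
      rw [div_mul_eq_mul_div, div_le_iff₀ hs, Real.mul_self_sqrt hEpos.le]
      linarith
    linarith
  refine (integralLE_sq_mul_log_sq_of_bounded hw.1 h1 (hb.mono fun s h => h.trans hle)).mono
    (le_of_eq ?_)
  rw [Real.log_mul two_ne_zero hs.ne', Real.log_sqrt hEpos.le]
  ring

end dimensionOne

/-! ### The smallest constant. -/

section optimalConstant
variable {d : ℕ}

/-- A normalized bump in s, independent of θ. Its finite entropy keeps the admissible constants away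
from 0. -/
theorem exists_isH1Cylinder_integrable_entropy (hd : 1 ≤ d) :
    ∃ w G, IsH1Cylinder d w G ∧ ∫ y, w y ^ 2 ∂(cylinderMeasure d) = 1 ∧
      Integrable (fun y => w y ^ 2 * Real.log (w y ^ 2)) (cylinderMeasure d) := by
  let b : ContDiffBump (0 : ℝ) := ⟨1, 2, one_pos, one_lt_two⟩
  have : Nonempty (Fin d) := ⟨⟨0, hd⟩⟩
  obtain ⟨θ, hθ⟩ := NormedSpace.sphere_nonempty (x := (0 : RSpace d)) (r := 1) |>.2 zero_le_one
  have : IsFiniteMeasureOnCompacts (cylinderMeasure d) := by unfold cylinderMeasure; infer_instance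
  have : (cylinderMeasure d).IsOpenPosMeasure := by unfold cylinderMeasure; infer_instance
  have hsupp : ∀ {E : Type} [NormedAddCommGroup E] {f : Cylinder d → E},
      (∀ y : Cylinder d, 2 ≤ ‖y.1‖ → f y = 0) → HasCompactSupport f := fun {E} _ {f} hf => by
    refine HasCompactSupport.intro ((isCompact_closedBall (0 : ℝ) 2).prod isCompact_univ)
      fun y hy => hf y ?_
    by_contra! h
    exact hy ⟨mem_closedBall_zero_iff.2 h.le, trivial⟩
  have hb0 : ∀ s : ℝ, 2 ≤ ‖s‖ → b s = 0 := fun s hs =>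
    b.zero_of_le_dist (by rwa [dist_zero_right])
  -- A zero of the nonnegative function b is a minimum; this covers the edge |s| = 2 too.
  have hbd0 : ∀ s : ℝ, 2 ≤ ‖s‖ → deriv b s = 0 := fun s hs => by
    refine IsLocalMin.deriv_eq_zero (Eventually.of_forall fun t => ?_)
    rw [hb0 s hs]; exact b.nonneg
  have hcb : Continuous fun y : Cylinder d => b y.1 := b.continuous.comp continuous_fst
  have hpos : 0 < ∫ y : Cylinder d, b y.1 ^ 2 ∂(cylinderMeasure d) := by
    refine (hcb.pow 2).integral_pos_of_hasCompactSupport_nonneg_nonzero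
      (hsupp fun y hy => by simp [hb0 _ hy]) (fun y => sq_nonneg _) (x := ((0 : ℝ), ⟨θ, hθ⟩)) ?_
    have : b (0 : ℝ) = 1 := b.one_of_mem_closedBall (Metric.mem_closedBall_self zero_le_one)
    simp [this]
  set m := ∫ y : Cylinder d, b y.1 ^ 2 ∂(cylinderMeasure d)
  let φ : ℝ × RSpace d → ℝ := fun p => (√m)⁻¹ * b p.1
  have hφ : ContDiff ℝ ∞ φ := contDiff_const.mul (b.contDiff.comp contDiff_fst)
  have hcw : Continuous (cylinderRestrict φ) := continuous_const.mul hcb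
  have hw0 : ∀ y : Cylinder d, 2 ≤ ‖y.1‖ → cylinderRestrict φ y = 0 := fun y hy => by
    simp only [cylinderRestrict, φ, hb0 _ hy, mul_zero]
  have hg : cylinderGrad φ = fun y : Cylinder d =>
      WithLp.toLp 2 ((√m)⁻¹ * deriv b y.1, (0 : RSpace d)) := funext fun y => by
    have hbd : DifferentiableAt ℝ b y.1 := (b.contDiff (n := 1)).differentiable one_ne_zero _
    rw [← deriv_const_mul_field, ← cylinderGrad_comp_fst (hbd.const_mul _)]
  have m1 : MemLp (cylinderRestrict φ) 2 (cylinderMeasure d) :=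
    hcw.memLp_of_hasCompactSupport (hsupp hw0)
  have m2 : MemLp (cylinderGrad φ) 2 (cylinderMeasure d) := by
    rw [hg]
    refine Continuous.memLp_of_hasCompactSupport ?_ (hsupp fun y hy => by simp [hbd0 _ hy])
    exact (WithLp.prod_continuous_toLp 2 ℝ (RSpace d)).comp ((continuous_const.mul
      (((b.contDiff (n := 1)).continuous_deriv le_rfl).comp continuous_fst)).prodMk
      continuous_const)
  refine ⟨cylinderRestrict φ, cylinderGrad φ, ⟨m1, m2, fun _ => φ, fun _ => ⟨hφ, m1, m2⟩, ?_, ?_⟩,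
    ?_, ?_⟩
  · simp
  · simp
  · simp only [cylinderRestrict, φ, mul_pow, integral_const_mul, inv_pow, Real.sq_sqrt hpos.le]
    exact inv_mul_cancel₀ hpos.ne'
  · refine Continuous.integrable_of_hasCompactSupport ?_ (hsupp fun y hy => by simp [hw0 _ hy])
    exact Real.continuous_mul_log.comp (hcw.pow 2)

theorem exists_isLeast_cylinderLogHardy (hd : 1 ≤ d) {a γ : ℝ} (ha : a < ((d : ℝ) - 2) / 2)
    (hγ : 0 < γ) (hne : ∃ K, 0 < K ∧ CylinderLogHardy d a γ K) :
    ∃ C, IsLeast {K : ℝ | 0 < K ∧ CylinderLogHardy d a γ K} C := by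
  set S := {K : ℝ | 0 < K ∧ CylinderLogHardy d a γ K}
  have hE : ∀ G : Cylinder d → WithLp 2 (ℝ × RSpace d),
      0 < (∫ y, ‖G y‖ ^ 2 ∂(cylinderMeasure d)) + ((d : ℝ) - 2 - 2 * a) ^ 2 / 4 := fun G => by
    have h1 : 0 ≤ ∫ y, ‖G y‖ ^ 2 ∂(cylinderMeasure d) := integral_nonneg fun y => sq_nonneg _
    have h2 : 0 < (d : ℝ) - 2 - 2 * a := by linarith
    positivity
  have hS : S.Nonempty := hne
  obtain ⟨w₀, G₀, h0, h1, h2⟩ := exists_isH1Cylinder_integrable_entropy hd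
  set E₀ := (∫ y, ‖G₀ y‖ ^ 2 ∂(cylinderMeasure d)) + ((d : ℝ) - 2 - 2 * a) ^ 2 / 4
  have hE0 : 0 < E₀ := hE G₀
  -- The constant that gives equality for w₀.
  set K₀ := Real.exp ((∫ y, w₀ y ^ 2 * Real.log (w₀ y ^ 2) ∂(cylinderMeasure d)) / (2 * γ)) / E₀
  have hK0 : 0 < K₀ := by positivity
  have hlb : ∀ K ∈ S, K₀ ≤ K := fun K hK => by
    have h3 := (hK.2 w₀ G₀ h0 h1).2 h2
    rw [div_le_iff₀ hE0, ← Real.le_log_iff_exp_le (mul_pos hK.1 hE0), div_le_iff₀ (by positivity)]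
    linarith
  have hbdd : BddBelow S := ⟨K₀, hlb⟩
  have hC : 0 < sInf S := hK0.trans_le (le_csInf hS hlb)
  refine ⟨sInf S, ⟨hC, fun w G hw hw1 => ?_⟩, fun K hK => csInf_le hbdd hK⟩
  obtain ⟨K₁, hK₁⟩ := hS
  -- Integrability of the positive part does not involve the constant, so any admissible K₁ supplies
  -- it; the bound itself passes to the limit by continuity of log at a positive point.
  refine ⟨(hK₁.2 w G hw hw1).1, fun hi => ?_⟩
  obtain ⟨u, -, hu, huS⟩ := exists_seq_tendsto_sInf ⟨K₁, hK₁⟩ hbdd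
  have hlim : Tendsto (fun n => 2 * γ * Real.log (u n * ((∫ y, ‖G y‖ ^ 2 ∂(cylinderMeasure d)) +
      ((d : ℝ) - 2 - 2 * a) ^ 2 / 4))) atTop (𝓝 (2 * γ * Real.log (sInf S *
      ((∫ y, ‖G y‖ ^ 2 ∂(cylinderMeasure d)) + ((d : ℝ) - 2 - 2 * a) ^ 2 / 4)))) :=
    ((hu.mul_const _).log (mul_pos hC (hE G)).ne').const_mul _
  exact ge_of_tendsto' hlim fun n => ((huS n).2 w G hw hw1).2 hi

end optimalConstant

end

/-! ### Conclusion. -/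

theorem theoremA (d : ℕ) (hd : 1 ≤ d) (a γ : ℝ) (ha : a < ((d : ℝ) - 2) / 2)
    (hγ : (d : ℝ) / 4 ≤ γ) (hγ2 : d = 2 → 1 / 2 < γ) :
    ∃ C : ℝ,
      IsLeast {K : ℝ | 0 < K ∧ WeightedLogHardy d a γ K} C ∧
      IsLeast {K : ℝ | 0 < K ∧ CylinderLogHardy d a γ K} C ∧
      (d = 1 → IsLeast {K : ℝ | 0 < K ∧ LineLogHardy a γ K} C) := by
  have hd' : (1 : ℝ) ≤ d := by exact_mod_cast hd
  have hγ0 : 0 < γ := by linarith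
  have hne : ∃ K, 0 < K ∧ CylinderLogHardy d a γ K := by
    rcases hd.eq_or_lt with rfl | h2
    · norm_num at ha hγ
      obtain ⟨K, hK, h⟩ := exists_lineLogHardy (a := a) (γ := γ) (by linarith) hγ
      exact ⟨K, hK, h.cylinder (by linarith) hγ0 hK⟩
    · exact exists_cylinderLogHardy_of_two_le h2 ha hγ
  obtain ⟨C, hC⟩ := exists_isLeast_cylinderLogHardy hd ha hγ0 hne
  refine ⟨C, ?_, hC, ?_⟩
  · simpa only [weightedLogHardy_iff hd ha] using hC
  · rintro rfl
    norm_num at ha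
    have : {K : ℝ | 0 < K ∧ LineLogHardy a γ K} = {K : ℝ | 0 < K ∧ CylinderLogHardy 1 a γ K} :=
      Set.ext fun K => and_congr_right fun hK =>
        ⟨fun h => h.cylinder (by linarith) hγ0 hK, fun h => h.line⟩
    rwa [this]
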